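/- **Model.** In the randomized $\mathsf{CONGESTED}\text{-}\mathsf{CLIQUE}$ model, every vertex of the $n$-vertex input graph $G=(V,E)$ hosts a processor with unbounded computational power and a private stream of independent fair random bits. Initially, each processor $v$ knows $n$, the maximum degree $\Delta$ of $G$, its own unique $O(\log n)$-bit ID, the IDs of its neighbors in $G$, and its own input. Time is divided into synchronous rounds; in each round every vertex sends $n-1$ messages of $O(\log n)$ bits, one addressed to each other vertex (whether or not they are adjacent in $G$). At the end each vertex declares its output. **Problem.** In $(\Delta+1)$-list coloring, the input of each vertex $v$ is a palette $\Psi(v)$ of exactly $\Delta+1$ colors, each color being represented by $O(\log n)$ bits; the goal is that every vertex $v$ outputs a color of $\Psi(v)$ such that adjacent vertices output different colors. **Theorem.** Suppose $\Delta=\Omega(\log^{4+\epsilon} n)$ for some constant $\epsilon>0$. Then there is a randomized algorithm that solves $(\Delta+1)$-list coloring in $\mathsf{CONGESTED}\text{-}\mathsf{CLIQUE}$ in $O(1)$ rounds, with success probability at least $1-1/\mathrm{poly}(n)$. Precisely: for all constants $\epsilon>0$, $c>0$, $N\in\mathbb N$, $a\in\mathbb N$ and $d\in\mathbb N$ there are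 constants $R$ and $B$, depending only on $\epsilon,c,N,a,d$, and an $R$-round randomized algorithm with messages of $B\,(\lfloor\log_2 n\rfloor+1)$ bits, such that the following holds for every $n$ and every $n$-vertex graph whose maximum degree $\Delta$ satisfies $\Delta\ge c\,(\log n)^{4+\epsilon}$ if $n\ge N$. For every assignment of distinct IDs and of palettes of size $\Delta+1$ to the vertices, in which each ID and each color is a number of at most $a\,(\lfloor\log_2 n\rfloor+1)$ bits, the probability that the output is not a proper coloring of $G$ with each vertex colored from its palette is at most $1/n^{d}$. -/

import Mathlib

open MeasureTheory
open scoped ENNReal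

namespace CongestedClique

/-- The number of bits in the binary representation of `n` (for `n ≥ 1`), which is the unit
`Θ(log n)` in which lengths of messages, of IDs and of colors are measured. -/
def logBits (n : ℕ) : ℕ := Nat.log 2 n + 1

/-- A message of `b` bits. -/
abbrev Message (b : ℕ) : Type := Fin b → Bool

/-- What a processor `v` knows about the input at the beginning (besides the global parameters
`n` and `Δ`): its own ID, the IDs of its neighbors in the input graph, and its palette. -/
structure LocalInput where
  ownId : ℕ
  nbrIds : Finset ℕ
  palette : Finset ℕ

/-- The program run by every processor, with messages of `b` bits. Local computation is unbounded:
the four components are arbitrary functions.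
* `init` makes the initial state from the local input and the private stream of random bits;
* `send s i` is the message that a processor in state `s` addresses to the processor with ID `i`;
* `recv s M` is the state after receiving the set `M` of pairs (ID of the sender, message);
* `output s` is the color declared at the end. -/
structure Algorithm (b : ℕ) where
  State : Type
  init : LocalInput → (ℕ → Bool) → State
  send : State → ℕ → Message b
  recv : State → Finset (ℕ × Message b) → State
  output : State → ℕ

/-- The local inputs of the processors for the graph `G`, the IDs `ident` and the palettes `Ψ`. -/
def localInput {n : ℕ} (G : SimpleGraph (Fin n)) [DecidableRel G.Adj] (ident : Fin n → ℕ)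
    (Ψ : Fin n → Finset ℕ) (v : Fin n) : LocalInput where
  ownId := ident v
  nbrIds := (G.neighborFinset v).image ident
  palette := Ψ v

/-- The messages that reach processor `v` in one round, when the current states are `S`: every
other processor `u` sends one message to `v`, and `v` sees the ID of the sender. -/
def inbox {n b : ℕ} (A : Algorithm b) (ident : Fin n → ℕ) (S : Fin n → A.State) (v : Fin n) :
    Finset (ℕ × Message b) :=
  (Finset.univ.erase v).image fun u => (ident u, A.send (S u) (ident v))

/-- The states of all processors after `t` synchronous rounds, where `x v` is the local input and
`ω v` the private stream of random bits of `v`. -/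
def statesAfter {n b : ℕ} (A : Algorithm b) (ident : Fin n → ℕ) (x : Fin n → LocalInput)
    (ω : Fin n → ℕ → Bool) : ℕ → Fin n → A.State
  | 0 => fun v => A.init (x v) (ω v)
  | t + 1 => fun v =>
      A.recv (statesAfter A ident x ω t v) (inbox A ident (statesAfter A ident x ω t) v)

/-- The colors declared by the processors after `R` rounds, on the list coloring instance with
graph `G`, IDs `ident` and palettes `Ψ`, when the private random bits are `ω`. -/
def result {n b : ℕ} (A : Algorithm b) (R : ℕ) (G : SimpleGraph (Fin n)) [DecidableRel G.Adj]
    (ident : Fin n → ℕ) (Ψ : Fin n → Finset ℕ) (ω : Fin n → ℕ → Bool) (v : Fin n) : ℕ :=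
  A.output (statesAfter A ident (localInput G ident Ψ) ω R v)

/-- `f` is a proper coloring of `G` in which every vertex has a color of its own palette. -/
def IsListColoring {n : ℕ} (G : SimpleGraph (Fin n)) (Ψ : Fin n → Finset ℕ) (f : Fin n → ℕ) :
    Prop :=
  (∀ v, f v ∈ Ψ v) ∧ ∀ u v, G.Adj u v → f u ≠ f v

/-- A fair coin. -/
noncomputable def fairCoin : Measure Bool := (PMF.uniformOfFintype Bool).toMeasure

/-- The law of the random bits of `n` processors: every processor has an infinite stream of
fair random bits, and all the bits of all the processors are independent. -/
noncomputable def coins (n : ℕ) : Measure (Fin n → ℕ → Bool) :=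
  Measure.pi fun _ => Measure.infinitePi fun _ => fairCoin

end CongestedClique

/-! Choose `m` with `m ^ 8 ≤ Δ < 2 * m ^ 8`. For large `n` the hypothesis on `Δ` makes `m ^ 2`
exceed any prescribed multiple of `log n`, so a deviation of `m / 32` times the square root of the
mean has inverse polynomial probability. Hash the IDs to `m ^ 4` labels; the vertices with one label
form a part. Labels in `[m ^ (3 - t), m ^ (4 - t))` have level `t < 4`, and label `0` has level `4`.
The levels are colored in order. At level `t < 4` another hash function distributes the colors among
the parts of that level, so these parts use disjoint colors and each can be colored greedily by one
leader. A part has `O(n / m ^ 4)` vertices, each reporting at most `3 * m ^ 4` neighbors in the part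
and as many colors, so a leader receives `O(n)` words, which can be routed in two rounds.

A vertex has at most `Δ / m ^ 4 + m ^ 3 / 16` neighbors in its part. Before level `t`, about a
fraction `1 / m ^ t` of all its neighbors is uncolored, hence at least `(Δ - m ^ 7 / 16) / m ^ t`
colors are left for it. They are shared by only `m ^ (3 - t) * (m - 1)` parts. Dividing `Δ` by `m ^
3 * (m - 1)` instead of `m ^ 4` gains at least `Δ / m ^ 5 ≥ m ^ 3`, more than all the errors
together (`card_colors_gt`, `layered_good`). In the last part every remaining color is allowed, and
palettes of size `Δ + 1` suffice without any probability.

Truly random hash functions are too long to broadcast. By the probabilistic method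
(`exists_hashFamily`) there are families of polynomial size in which every pair of a key set and a
value set is badly treated by few members. Five indices into such families form the seed, drawn by
the processor of smallest ID. The hash function of level `t` is independent of the coloring before
that level, so a union bound over the vertices applies (`card_filter_apply_le`, `badColors_update`).
One round publishes the seed and each of the five levels takes four rounds (`Computes.stage`). For
`n` below a constant a single part suffices. -/

namespace CongestedClique

/-! ### A calculus of what processors can know after a given number of rounds. -/

/-- A family of executions of algorithms with `n` processors: IDs, local inputs, random bits. -/
structure Runs (n : ℕ) (ι : Type) where
  ident : ι → Fin n → ℕ
  ident_injective : ∀ I, Function.Injective (ident I)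
  input : ι → Fin n → LocalInput
  bits : ι → Fin n → ℕ → Bool
  ownId_input : ∀ I v, (input I v).ownId = ident I v

namespace Runs

variable {n : ℕ} {ι : Type} (P : Runs n ι)

/-- Some algorithm with `b`-bit messages lets every processor `v` know `K I v` after `R` rounds,
in all executions `I` of the family. -/
def Computes (b R : ℕ) {α : Type} (K : ι → Fin n → α) : Prop :=
  ∃ (A : Algorithm b) (g : A.State → α), ∀ I v,
    g (statesAfter A (P.ident I) (P.input I) (P.bits I) R v) = K I v

/-- What `v` receives, by ID of the sender, if a processor with knowledge `k` addresses the
message `send k i` to the processor with ID `i`. -/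
noncomputable def received {α μ : Type} (K : ι → Fin n → α) (send : α → ℕ → μ) (I : ι) (v : Fin n)
    (i : ℕ) : Option μ :=
  (Function.partialInv (P.ident I) i).map fun u => send (K I u) (P.ident I v)

variable {P}

theorem received_ident {α μ : Type} (K : ι → Fin n → α) (send : α → ℕ → μ) (I : ι) (u v : Fin n) :
    P.received K send I v (P.ident I u) = some (send (K I u) (P.ident I v)) := by
  simp [received, Function.partialInv_left (P.ident_injective I)]

theorem received_eq_none {α μ : Type} (K : ι → Fin n → α) (send : α → ℕ → μ) (I : ι) (v : Fin n)
    {i : ℕ} (hi : ∀ u, P.ident I u ≠ i) : P.received K send I v i = none := by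
  have : Function.partialInv (P.ident I) i = none := by
    rw [Function.partialInv, dif_neg]
    rintro ⟨u, hu⟩
    exact hi u hu
  simp [received, this]

theorem computes_initial (b : ℕ) : P.Computes b 0 fun I v => (P.input I v, P.bits I v) :=
  ⟨{ State := LocalInput × (ℕ → Bool)
     init := fun x ω => (x, ω)
     send := fun _ _ _ => false
     recv := fun s _ => s
     output := fun _ => 0 }, id, fun _ _ => rfl⟩

theorem Computes.map {b R : ℕ} {α β : Type} {K : ι → Fin n → α} {K' : ι → Fin n → β}
    (h : P.Computes b R K) (f : α → β) (hf : ∀ I v, K' I v = f (K I v)) : P.Computes b R K' := by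
  obtain ⟨A, g, hg⟩ := h
  exact ⟨A, f ∘ g, fun I v => by rw [hf, ← hg]; rfl⟩

open Classical in
/-- The algorithm that runs `A` for `R` rounds and then one round in which a processor that has
the state `s` addresses the (encoded) message `send s i` to `i`. -/
noncomputable def appendRound {b : ℕ} (A : Algorithm b) (R : ℕ) {μ : Type}
    (e : μ → Message b) (send : A.State → ℕ → μ) : Algorithm b where
  -- The components are the own ID, a clock, the simulated state of `A`, and what was received in
  -- the extra round.
  State := ℕ × ℕ × A.State × (ℕ → Option μ)
  init x ω := (x.ownId, 0, A.init x ω, fun _ => none)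
  send s i := if s.2.1 < R then A.send s.2.2.1 i else e (send s.2.2.1 i)
  recv s M :=
    if s.2.1 < R then (s.1, s.2.1 + 1, A.recv s.2.2.1 M, s.2.2.2)
    else (s.1, s.2.1 + 1, s.2.2.1, fun i =>
      if i = s.1 then some (send s.2.2.1 i)
      else if h : ∃ x : μ, (i, e x) ∈ M then some h.choose else none)
  output _ := 0

theorem statesAfter_appendRound {b : ℕ} (A : Algorithm b) (R : ℕ) {μ : Type}
    (e : μ → Message b) (send : A.State → ℕ → μ) (I : ι) {t : ℕ} (ht : t ≤ R) :
    statesAfter (appendRound A R e send) (P.ident I) (P.input I) (P.bits I) t = fun v =>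
      (P.ident I v, t, statesAfter A (P.ident I) (P.input I) (P.bits I) t v, fun _ => none) := by
  induction t with
  | zero => funext v; simp [statesAfter, appendRound, P.ownId_input]
  | succ t ih =>
    have ht' : t < R := ht
    funext v
    rw [statesAfter, ih ht'.le]
    simp [appendRound, ht', statesAfter, inbox]

/-- A processor supplies its missing message to itself locally, so later arguments need not
distinguish sender from receiver. Injectivity of the encoding makes the decoded message unique. -/
theorem Computes.round {b R : ℕ} {α μ : Type} {K : ι → Fin n → α} (h : P.Computes b R K)
    [Fintype μ] (hμ : Fintype.card μ ≤ 2 ^ b) (send : α → ℕ → μ) :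
    P.Computes b (R + 1) fun I v => (K I v, P.received K send I v) := by
  obtain ⟨A, g, hg⟩ := h
  obtain ⟨e⟩ : Nonempty (μ ↪ Message b) := by
    apply Function.Embedding.nonempty_of_card_le
    simpa [Message] using hμ
  refine ⟨appendRound A R e fun s => send (g s), fun s => (g s.2.2.1, s.2.2.2), fun I v => ?_⟩
  rw [statesAfter, statesAfter_appendRound _ _ _ _ _ le_rfl]
  simp only [appendRound, lt_irrefl, if_false, hg, inbox]
  refine Prod.ext rfl (funext fun i => ?_)
  dsimp only
  by_cases hi : ∃ u, P.ident I u = i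
  · obtain ⟨u, rfl⟩ := hi
    rw [received_ident]
    by_cases huv : u = v
    · subst huv; simp
    rw [if_neg fun h => huv (P.ident_injective I h)]
    have key : ∀ x : μ, (P.ident I u, e x) ∈ (Finset.univ.erase v).image
        (fun u => (P.ident I u, e (send (K I u) (P.ident I v)))) ↔
        x = send (K I u) (P.ident I v) := by
      intro x
      simp only [Finset.mem_image, Finset.mem_erase, Finset.mem_univ, and_true, Prod.mk.injEq]
      constructor
      · rintro ⟨w, -, hw, hx⟩
        rw [P.ident_injective I hw] at hx
        exact (e.injective hx).symm
      · rintro rfl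
        exact ⟨u, huv, rfl, rfl⟩
    have hex : ∃ x : μ, (P.ident I u, e x) ∈ (Finset.univ.erase v).image
        (fun u => (P.ident I u, e (send (K I u) (P.ident I v)))) := ⟨_, (key _).2 rfl⟩
    rw [dif_pos hex]
    exact congrArg some ((key _).1 hex.choose_spec)
  · push Not at hi
    rw [received_eq_none _ _ _ _ hi, if_neg (hi v).symm, dif_neg]
    rintro ⟨x, hx⟩
    simp only [Finset.mem_image, Finset.mem_erase, Prod.mk.injEq] at hx
    obtain ⟨u, -, hu, -⟩ := hx
    exact hi u hu

end Runs

/-! ### Enumeration and truncation of finite sets. -/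

/-- The position of `i` in a fixed enumeration of `A`. -/
noncomputable def rank (A : Finset ℕ) (i : ℕ) : ℕ := if h : i ∈ A then A.equivFin ⟨i, h⟩ else 0

/-- The element at position `r` in the enumeration of `A`. -/
noncomputable def nth (A : Finset ℕ) (r : ℕ) : ℕ :=
  if h : r < A.card then (A.equivFin.symm ⟨r, h⟩ : A) else 0

theorem rank_lt {A : Finset ℕ} {i : ℕ} (hi : i ∈ A) : rank A i < A.card := by
  rw [rank, dif_pos hi]; exact Fin.is_lt _

theorem nth_mem {A : Finset ℕ} {r : ℕ} (hr : r < A.card) : nth A r ∈ A := by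
  rw [nth, dif_pos hr]; exact Subtype.prop _

theorem nth_rank {A : Finset ℕ} {i : ℕ} (hi : i ∈ A) : nth A (rank A i) = i := by
  rw [nth, dif_pos (rank_lt hi)]
  simp [rank, hi]

theorem rank_nth {A : Finset ℕ} {r : ℕ} (hr : r < A.card) : rank A (nth A r) = r := by
  rw [rank, dif_pos (nth_mem hr)]
  simp [nth, hr]

/-- The first `s` elements of `A` in the enumeration. -/
noncomputable def trunc (s : ℕ) (A : Finset ℕ) : Finset ℕ :=
  (Finset.range (min s A.card)).image (nth A)

theorem card_trunc (s : ℕ) (A : Finset ℕ) : (trunc s A).card = min s A.card := by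
  rw [trunc, Finset.card_image_of_injOn, Finset.card_range]
  intro i hi j hj hij
  simp only [Finset.coe_range, Set.mem_Iio, lt_min_iff] at hi hj
  rw [← rank_nth hi.2, hij, rank_nth hj.2]

theorem trunc_subset (s : ℕ) (A : Finset ℕ) : trunc s A ⊆ A := by
  intro i hi
  simp only [trunc, Finset.mem_image, Finset.mem_range, lt_min_iff] at hi
  obtain ⟨j, hj, rfl⟩ := hi
  exact nth_mem hj.2

theorem trunc_eq_self {s : ℕ} {A : Finset ℕ} (h : A.card ≤ s) : trunc s A = A :=
  Finset.eq_of_subset_of_card_le (trunc_subset s A) (by rw [card_trunc, min_eq_right h])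

/-- The element at position `j` in the enumeration of `A`, if there is one. -/
noncomputable def nth? (A : Finset ℕ) (j : ℕ) : Option ℕ :=
  if j < A.card then some (nth A j) else none

theorem mem_trunc_iff {s : ℕ} {A : Finset ℕ} {i : ℕ} :
    i ∈ trunc s A ↔ ∃ j < s, nth? A j = some i := by
  simp only [trunc, Finset.mem_image, Finset.mem_range, lt_min_iff, nth?]
  constructor
  · rintro ⟨j, hj, rfl⟩
    exact ⟨j, hj.1, if_pos hj.2⟩
  · rintro ⟨j, hj, h⟩
    split_ifs at h with hj'
    exact ⟨j, ⟨hj, hj'⟩, Option.some.inj h⟩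

theorem mem_of_nth? {A : Finset ℕ} {i j : ℕ} (h : nth? A j = some i) : i ∈ A :=
  trunc_subset (j + 1) A (mem_trunc_iff.2 ⟨j, j.lt_succ_self, h⟩)

/-- The IDs with label `x`. -/
def members (ids : Finset ℕ) (lab : ℕ → ℕ) (x : ℕ) : Finset ℕ := {i ∈ ids | lab i = x}

@[simp] theorem mem_members {ids : Finset ℕ} {lab : ℕ → ℕ} {x i : ℕ} :
    i ∈ members ids lab x ↔ i ∈ ids ∧ lab i = x := Finset.mem_filter

/-! ### Balanced routing to the leaders. -/

namespace Runs

variable {n : ℕ} {ι : Type} (P : Runs n ι)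

/-- The set of all IDs. -/
def ids (I : ι) : Finset ℕ := Finset.univ.image (P.ident I)

variable {P}

theorem ident_mem_ids (I : ι) (v : Fin n) : P.ident I v ∈ P.ids I :=
  Finset.mem_image_of_mem _ (Finset.mem_univ v)

theorem exists_of_mem_ids {I : ι} {i : ℕ} (hi : i ∈ P.ids I) : ∃ u, P.ident I u = i := by
  simpa [ids] using hi

theorem card_ids (I : ι) : (P.ids I).card = n := by
  rw [ids, Finset.card_image_of_injective _ (P.ident_injective I), Finset.card_univ,
    Fintype.card_fin]

theorem partialInv_eq_none {I : ι} {i : ℕ} (hi : i ∉ P.ids I) :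
    Function.partialInv (P.ident I) i = none := by
  rw [Function.partialInv, dif_neg]
  rintro ⟨u, rfl⟩
  exact hi (ident_mem_ids I u)

/-- Two-round routing to the leaders of the parts of a publicly known partition: every processor
transfers `s` words to the leader of its part, where the leader of part `x` is the processor at
position `x`. -/
theorem Computes.route {b R C s : ℕ} {α W : Type} [Fintype W] [Inhabited W]
    {K : ι → Fin n → α} (h : P.Computes b R K) (hW : Fintype.card W ^ C ≤ 2 ^ b)
    (own : α → ℕ) (hown : ∀ I v, own (K I v) = P.ident I v)
    (ids : α → Finset ℕ) (hids : ∀ I v, ids (K I v) = P.ids I)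
    (lab : α → ℕ → ℕ) (labI : ι → ℕ → ℕ) (hlab : ∀ I v, lab (K I v) = labI I)
    (hload : ∀ I x, (members (P.ids I) (labI I) x).card * s ≤ C * n)
    (word : α → ℕ → W) :
    P.Computes b (R + 2) fun I v => (K I v, fun i j =>
      if labI I i = rank (P.ids I) (P.ident I v) ∧ j < s then
        (Function.partialInv (P.ident I) i).map fun u => word (K I u) j else none) := by
  have hcard : Fintype.card (Fin C → W) ≤ 2 ^ b := by simpa using hW
  have h1 := h.round hcard fun k i c =>
    -- The words of a part are numbered consecutively, the member of rank `r` owning `r * s, …, r *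
    -- s + s - 1`. Word `q` travels through the processor of rank `q % n` in slot `q / n` of the
    -- message. Slots outside the sender's interval carry values that are never read.
    let q := c * n + rank (ids k) i
    let r := rank (members (ids k) (lab k) (lab k (own k))) (own k)
    if r * s ≤ q then word k (q - r * s) else default
  have h2 := h1.round hcard fun k i c =>
    let q := c * n + rank (ids k.1) (own k.1)
    -- The partition is public, so the intermediate processor can compute the owner of word `q` and
    -- forward the right slot.
    let u := nth (members (ids k.1) (lab k.1) (rank (ids k.1) i)) (q / s)
    (k.2 u).getD default c
  refine h2.map (fun k => (k.1.1, fun i j =>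
    let q := rank (members (ids k.1.1) (lab k.1.1) (lab k.1.1 i)) i * s + j
    let w := nth (ids k.1.1) (q % n)
    if i ∈ ids k.1.1 ∧ lab k.1.1 i = rank (ids k.1.1) (own k.1.1) ∧ j < s then
      if hc : q / n < C then some ((k.2 w).getD default ⟨q / n, hc⟩) else none
    else none)) fun I v => Prod.ext rfl (funext fun i => funext fun j => ?_)
  dsimp only
  rw [hids, hlab, hown]
  by_cases hi : i ∈ P.ids I
  swap
  · simp [hi, partialInv_eq_none hi]
  by_cases hx : labI I i = rank (P.ids I) (P.ident I v) ∧ j < s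
  swap
  · rw [if_neg hx, if_neg fun h => hx h.2]
  rw [if_pos hx, if_pos ⟨hi, hx⟩]
  obtain ⟨u, rfl⟩ := exists_of_mem_ids hi
  obtain ⟨hx, hj⟩ := hx
  rw [Function.partialInv_left (P.ident_injective I), Option.map_some]
  set M := members (P.ids I) (labI I) (labI I (P.ident I u)) with hM
  have hu : P.ident I u ∈ M := by simp [hM, hi]
  set r := rank M (P.ident I u) with hr
  have hrM : r < M.card := rank_lt hu
  have hn : 0 < n := Fin.pos v
  have hq : r * s + j < C * n :=
    calc r * s + j < (r + 1) * s := by rw [add_mul, one_mul]; omega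
      _ ≤ M.card * s := Nat.mul_le_mul_right _ hrM
      _ ≤ C * n := hload I _
  have hqc : (r * s + j) / n < C := Nat.div_lt_of_lt_mul (by rw [mul_comm n C]; exact hq)
  have hqn : (r * s + j) % n < (P.ids I).card := by rw [card_ids]; exact Nat.mod_lt _ hn
  rw [dif_pos hqc]
  obtain ⟨w, hw⟩ := exists_of_mem_ids (nth_mem hqn)
  have hqs : (r * s + j) / s = r := by
    rw [mul_comm, Nat.mul_add_div (by omega), Nat.div_eq_of_lt hj, add_zero]
  rw [← hw, received_ident]
  simp only [Option.getD_some, hids, hlab, hown]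
  rw [hw, rank_nth hqn, mul_comm ((r * s + j) / n) n, Nat.div_add_mod, hqs, ← hx, ← hM,
    nth_rank hu, received_ident]
  simp only [Option.getD_some, hids, hlab, hown]
  rw [hw, rank_nth hqn, ← hM, ← hr, mul_comm ((r * s + j) / n) n, Nat.div_add_mod,
    if_pos (Nat.le_add_right _ _), Nat.add_sub_cancel_left]

end Runs

/-! ### List coloring level by level. -/

section Coloring

/-- The neighbors in `N` that lie in the same part as `i`. -/
def partNbr (lab : ℕ → ℕ) (N : Finset ℕ) (i : ℕ) : Finset ℕ := {j ∈ N | lab j = lab i}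

open Classical in
/-- The colors of the palette `Q` that are not used by the neighbors `N`. -/
noncomputable def avail (col : ℕ → Option ℕ) (N Q : Finset ℕ) : Finset ℕ :=
  {c ∈ Q | ∀ j ∈ N, col j ≠ some c}

open Classical in
/-- The available colors that are allowed in the part of `i`. -/
noncomputable def partPal (lab : ℕ → ℕ) (allow : ℕ → ℕ → Prop) (col : ℕ → Option ℕ)
    (N Q : Finset ℕ) (i : ℕ) : Finset ℕ := {c ∈ avail col N Q | allow (lab i) c}

theorem mem_avail {col : ℕ → Option ℕ} {N Q : Finset ℕ} {c : ℕ} :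
    c ∈ avail col N Q ↔ c ∈ Q ∧ ∀ j ∈ N, col j ≠ some c := by simp [avail]

theorem mem_partPal {lab : ℕ → ℕ} {allow : ℕ → ℕ → Prop} {col : ℕ → Option ℕ} {N Q : Finset ℕ}
    {i c : ℕ} : c ∈ partPal lab allow col N Q i ↔ c ∈ avail col N Q ∧ allow (lab i) c := by
  simp [partPal]

/-- A list coloring of the vertices `M` with neighborhoods `nb` and palettes `pl`, if one exists. -/
noncomputable def listColor (M : Finset ℕ) (nb pl : ℕ → Finset ℕ) : ℕ → ℕ :=
  Classical.epsilon fun f => (∀ i ∈ M, f i ∈ pl i) ∧ ∀ i ∈ M, ∀ j ∈ nb i, f i ≠ f j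

/-- The choice made by `epsilon` depends only on the data inside `M`; hence a leader that knows just
its own part finds the coloring prescribed by the global formula. -/
theorem listColor_congr {M : Finset ℕ} {nb nb' pl pl' : ℕ → Finset ℕ} (hnb : ∀ i ∈ M, nb i = nb' i)
    (hpl : ∀ i ∈ M, pl i = pl' i) : listColor M nb pl = listColor M nb' pl' := by
  unfold listColor
  congr 1
  funext f
  refine propext (and_congr ?_ ?_)
  · exact forall₂_congr fun i hi => by rw [hpl i hi]
  · exact forall₂_congr fun i hi => by rw [hnb i hi]

/-- Greedy coloring: the vertex added last has more colors than neighbors. -/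
theorem exists_listColor (nb pl : ℕ → Finset ℕ) (hsymm : ∀ i j, j ∈ nb i → i ∈ nb j)
    (hirr : ∀ i, i ∉ nb i) (M : Finset ℕ) (h : ∀ i ∈ M, (nb i).card < (pl i).card) :
    ∃ f : ℕ → ℕ, (∀ i ∈ M, f i ∈ pl i) ∧ ∀ i ∈ M, ∀ j ∈ M, j ∈ nb i → f i ≠ f j := by
  induction M using Finset.induction_on with
  | empty => exact ⟨fun _ => 0, by simp, by simp⟩
  | insert a M ha ih =>
    obtain ⟨f, hf, hf'⟩ := ih fun i hi => h i (Finset.mem_insert_of_mem hi)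
    obtain ⟨c, hc, hc'⟩ : ∃ c ∈ pl a, c ∉ (nb a).image f :=
      Finset.exists_mem_notMem_of_card_lt_card
        (Finset.card_image_le.trans_lt (h a (Finset.mem_insert_self a M)))
    have hne : ∀ j ∈ nb a, c ≠ f j := fun j hj hcj => hc' (hcj ▸ Finset.mem_image_of_mem f hj)
    have hup : ∀ i ∈ M, Function.update f a c i = f i := fun i hi =>
      Function.update_of_ne (by rintro rfl; exact ha hi) _ _
    refine ⟨Function.update f a c, fun i hi => ?_, fun i hi j hj hij => ?_⟩
    · rcases Finset.mem_insert.1 hi with rfl | hi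
      · simpa using hc
      · rw [hup i hi]; exact hf i hi
    · rcases Finset.mem_insert.1 hi with hi' | hi' <;>
        rcases Finset.mem_insert.1 hj with hj' | hj'
      · subst hi' hj'; exact absurd hij (hirr _)
      · subst hi'; rw [hup j hj', Function.update_self]; exact hne j hij
      · subst hj'; rw [hup i hi', Function.update_self]; exact (hne i (hsymm _ _ hij)).symm
      · rw [hup i hi', hup j hj']; exact hf' i hi' j hj' hij

theorem listColor_spec {nb pl : ℕ → Finset ℕ} (hsymm : ∀ i j, j ∈ nb i → i ∈ nb j)
    (hirr : ∀ i, i ∉ nb i) {M : Finset ℕ} (hM : ∀ i ∈ M, nb i ⊆ M)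
    (h : ∀ i ∈ M, (nb i).card < (pl i).card) :
    (∀ i ∈ M, listColor M nb pl i ∈ pl i) ∧
      ∀ i ∈ M, ∀ j ∈ nb i, listColor M nb pl i ≠ listColor M nb pl j := by
  obtain ⟨f, hf, hf'⟩ := exists_listColor nb pl hsymm hirr M h
  exact Classical.epsilon_spec
    (p := fun f => (∀ i ∈ M, f i ∈ pl i) ∧ ∀ i ∈ M, ∀ j ∈ nb i, f i ≠ f j)
    ⟨f, hf, fun i hi j hj => hf' i hi j (hM i hi hj) hj⟩

variable (ids : Finset ℕ) (nbr pal : ℕ → Finset ℕ) (lab lev : ℕ → ℕ) (allow : ℕ → ℕ → Prop) (s : ℕ)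

/-- The partial coloring `col` extended to the parts of level `t`, every part being colored
with its own allowed colors. At most `s` neighbors and colors of every vertex are looked at. -/
noncomputable def stageCol (t : ℕ) (col : ℕ → Option ℕ) (i : ℕ) : Option ℕ :=
  if i ∈ ids ∧ lev (lab i) = t then
    some (listColor (members ids lab (lab i)) (fun j => trunc s (partNbr lab (nbr j) j))
      (fun j => trunc s (partPal lab allow col (nbr j) (pal j) j)) i)
  else col i

/-- The partial coloring after the levels below `t`. -/
noncomputable def colAfter : ℕ → ℕ → Option ℕ
  | 0 => fun _ => none
  | t + 1 => stageCol ids nbr pal lab lev allow s t (colAfter t)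

variable {ids nbr pal lab lev allow s}

theorem colAfter_of_le {t i : ℕ} (h : t ≤ lev (lab i)) :
    colAfter ids nbr pal lab lev allow s t i = none := by
  induction t with
  | zero => rfl
  | succ t ih =>
    rw [colAfter, stageCol, if_neg (by omega)]
    exact ih (by omega)

theorem colAfter_of_lt {t i : ℕ} (h : lev (lab i) < t) :
    colAfter ids nbr pal lab lev allow s t i =
      colAfter ids nbr pal lab lev allow s (lev (lab i) + 1) i := by
  induction t with
  | zero => omega
  | succ t ih =>
    rcases Nat.lt_succ_iff_lt_or_eq.1 h with h | h
    · rw [← ih h, colAfter, stageCol, if_neg (by omega)]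
    · rw [h]

variable (hids : ∀ i, nbr i ⊆ ids) (hsymm : ∀ i j, j ∈ nbr i → i ∈ nbr j)
  (hirr : ∀ i, i ∉ nbr i)
  (hdisj : ∀ x y c, lev x = lev y → allow x c → allow y c → x = y)
  (hdeg : ∀ i ∈ ids, (partNbr lab (nbr i) i).card < s)
  (hpal : ∀ i ∈ ids, (partNbr lab (nbr i) i).card < (partPal lab allow
    (colAfter ids nbr pal lab lev allow s (lev (lab i))) (nbr i) (pal i) i).card)

include hids hsymm hirr hdeg hpal in
-- Truncation is harmless: degrees in the part are below `s`, so no neighbor is lost, and a palette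
-- cut down to `s` colors still exceeds the degree.
theorem exists_colAfter_succ {i : ℕ} (hi : i ∈ ids) :
    ∃ c, colAfter ids nbr pal lab lev allow s (lev (lab i) + 1) i = some c ∧
      c ∈ partPal lab allow
        (colAfter ids nbr pal lab lev allow s (lev (lab i))) (nbr i) (pal i) i ∧
      ∀ j ∈ nbr i, lab j = lab i →
        colAfter ids nbr pal lab lev allow s (lev (lab j) + 1) j ≠ some c := by
  set M := members ids lab (lab i) with hM
  set col := colAfter ids nbr pal lab lev allow s (lev (lab i)) with hcol
  set nb := fun j => trunc s (partNbr lab (nbr j) j) with hnb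
  set pl := fun j => trunc s (partPal lab allow col (nbr j) (pal j) j) with hpl
  have hself : ∀ j ∈ M, nb j = partNbr lab (nbr j) j := fun j hj =>
    trunc_eq_self (hdeg j (mem_members.1 hj).1).le
  have key := listColor_spec (nb := fun j => partNbr lab (nbr j) j) (pl := pl)
    (fun a b hab => by
      simp only [partNbr, Finset.mem_filter] at hab ⊢
      exact ⟨hsymm a b hab.1, hab.2.symm⟩)
    (fun a ha => hirr a (Finset.mem_filter.1 ha).1) (M := M)
    (fun a ha b hb => by
      simp only [partNbr, Finset.mem_filter] at hb
      exact mem_members.2 ⟨hids a hb.1, hb.2.trans (mem_members.1 ha).2⟩)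
    (fun a ha => by
      obtain ⟨ha, hai⟩ := mem_members.1 ha
      have := hpal a ha
      rw [hai, ← hcol] at this
      rw [hpl, card_trunc]
      exact lt_min (hdeg a ha) this)
  rw [← listColor_congr hself fun _ _ => rfl] at key
  have hiM : i ∈ M := mem_members.2 ⟨hi, rfl⟩
  refine ⟨listColor M nb pl i, ?_, trunc_subset _ _ (key.1 i hiM), fun j hj hji => ?_⟩
  · rw [colAfter, stageCol, if_pos ⟨hi, rfl⟩]
  · have hj' : j ∈ ids := hids i hj
    rw [colAfter, stageCol, if_pos ⟨hj', rfl⟩, hji, ← hcol, ← hM]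
    intro h
    exact key.2 i hiM j (Finset.mem_filter.2 ⟨hj, hji⟩)
      (Option.some.inj h).symm

include hids hsymm hirr hdisj hdeg hpal in
/-- If no part has a vertex of degree `s` or more within the part, and every vertex has more
allowed colors than neighbors within its part, then the outcome is a list coloring. -/
theorem exists_colAfter {T : ℕ} (hT : ∀ i ∈ ids, lev (lab i) < T) {i : ℕ} (hi : i ∈ ids) :
    ∃ c ∈ pal i, colAfter ids nbr pal lab lev allow s T i = some c ∧
      ∀ j ∈ nbr i, colAfter ids nbr pal lab lev allow s T j ≠ some c := by
  have key := fun {i} (hi : i ∈ ids) => exists_colAfter_succ hids hsymm hirr hdeg hpal hi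
  obtain ⟨c, hc, hcp, hcn⟩ := key hi
  have hcp' := mem_partPal.1 hcp
  have hca := mem_avail.1 hcp'.1
  refine ⟨c, hca.1, by rw [colAfter_of_lt (hT i hi), hc], fun j hj hjc => ?_⟩
  have hj' : j ∈ ids := hids i hj
  rw [colAfter_of_lt (hT j hj')] at hjc
  obtain ⟨d, hd, hdp, -⟩ := key hj'
  have hdp' := mem_partPal.1 hdp
  have hda := mem_avail.1 hdp'.1
  obtain rfl : d = c := by rw [hd] at hjc; exact Option.some.inj hjc
  -- Whichever endpoint is colored later avoids the earlier color through `avail`; on equal levels a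
  -- common color forces a common part, where the leader's coloring is proper.
  rcases lt_trichotomy (lev (lab i)) (lev (lab j)) with h | h | h
  · exact hda.2 i (hsymm _ _ hj) (by rw [colAfter_of_lt h, hc])
  · exact hcn j hj (hdisj _ _ d h hcp'.2 hdp'.2).symm hd
  · exact hca.2 j hj (by rw [colAfter_of_lt h, hd])

end Coloring

/-! ### Execution of one level in four rounds. -/

/-- A number, if there is one below `D`. -/
def encode (D : ℕ) (o : Option ℕ) : Option (Fin D) :=
  o.bind fun c => if h : c < D then some ⟨c, h⟩ else none

/-- The number that was encoded. -/
def decode {D : ℕ} (o : Option (Fin D)) : Option ℕ := o.map Fin.val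

theorem decode_encode {D : ℕ} {o : Option ℕ} (h : ∀ c, o = some c → c < D) :
    decode (encode D o) = o := by
  cases o with
  | none => rfl
  | some c => simp [encode, decode, h c rfl]

/-- The set of the first `s` values of `f`. -/
def gather (s : ℕ) (f : ℕ → Option ℕ) : Finset ℕ :=
  (Finset.range s).biUnion fun j => (f j).toFinset

theorem gather_eq_trunc {s : ℕ} {f : ℕ → Option ℕ} {A : Finset ℕ} (h : ∀ j < s, f j = nth? A j) :
    gather s f = trunc s A := by
  ext i
  simp only [gather, Finset.mem_biUnion, Finset.mem_range, Option.mem_toFinset, Option.mem_def,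
    mem_trunc_iff]
  exact exists_congr fun j => and_congr_right fun hj => by rw [h j hj]

/-- The public part of a coloring algorithm: for every seed, a label for every ID (the name of its
part) and the colors that are allowed in every part; every part has a level. -/
structure Scheme (σ : Type) where
  lab : σ → ℕ → ℕ
  lev : ℕ → ℕ
  allow : σ → ℕ → ℕ → Prop

namespace Runs

variable {n : ℕ} {ι σ : Type} (P : Runs n ι)

/-- What the processors know between two stages. -/
def knowledge (seed : ι → σ) (col : ι → ℕ → Option ℕ) (I : ι) (v : Fin n) :
    LocalInput × Finset ℕ × σ × (ℕ → Option ℕ) := (P.input I v, P.ids I, seed I, col I)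

variable {P}

/-- Two rounds bring neighbors and palettes to the leaders, the third returns the colors, and the
fourth broadcasts them. Thus the whole partial coloring becomes common knowledge again, ready for
the next level. -/
theorem Computes.stage {b R C D s t : ℕ} {seed : ι → σ} {col : ι → ℕ → Option ℕ}
    (h : P.Computes b R (P.knowledge seed col)) (S : Scheme σ) {nbr pal : ι → ℕ → Finset ℕ}
    (hnbr : ∀ I v, (P.input I v).nbrIds = nbr I (P.ident I v))
    (hpal : ∀ I v, (P.input I v).palette = pal I (P.ident I v))
    (hnbrD : ∀ I i, ∀ j ∈ nbr I i, j < D) (hpalD : ∀ I i, ∀ c ∈ pal I i, c < D)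
    (hb : ((D + 1) * (D + 1)) ^ C ≤ 2 ^ b) (hb' : D + 1 ≤ 2 ^ b)
    (hload : ∀ I x, (members (P.ids I) (S.lab (seed I)) x).card * s ≤ C * n)
    (hlab : ∀ I, ∀ i ∈ P.ids I, S.lab (seed I) i < n)
    (hcol : ∀ I i c, stageCol (P.ids I) (nbr I) (pal I) (S.lab (seed I)) S.lev (S.allow (seed I)) s
      t (col I) i = some c → c < D) :
    P.Computes b (R + 4) (P.knowledge seed fun I => stageCol (P.ids I) (nbr I) (pal I)
      (S.lab (seed I)) S.lev (S.allow (seed I)) s t (col I)) := by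
  let word (I : ι) (u : Fin n) (j : ℕ) : Option (Fin D) × Option (Fin D) :=
    (encode D (nth? (partNbr (S.lab (seed I)) (nbr I (P.ident I u)) (P.ident I u)) j),
      encode D (nth? (partPal (S.lab (seed I)) (S.allow (seed I)) (col I) (nbr I (P.ident I u))
        (pal I (P.ident I u)) (P.ident I u)) j))
  have h2 := h.route (C := C) (s := s) (W := Option (Fin D) × Option (Fin D))
    (by simpa using hb) (fun k => k.1.ownId) P.ownId_input (fun k => k.2.1) (fun _ _ => rfl)
    (fun k => S.lab k.2.2.1) (fun I => S.lab (seed I)) (fun _ _ => rfl) hload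
    (fun k j => (encode D (nth? (partNbr (S.lab k.2.2.1) k.1.nbrIds k.1.ownId) j),
      encode D (nth? (partPal (S.lab k.2.2.1) (S.allow k.2.2.1) k.2.2.2 k.1.nbrIds k.1.palette
        k.1.ownId) j)))
  have hlist : ∀ I x, listColor (members (P.ids I) (S.lab (seed I)) x)
      (fun i => gather s fun j => (if S.lab (seed I) i = x ∧ j < s then
        (Function.partialInv (P.ident I) i).map fun u => word I u j else none).bind
          fun w => decode w.1)
      (fun i => gather s fun j => (if S.lab (seed I) i = x ∧ j < s then
        (Function.partialInv (P.ident I) i).map fun u => word I u j else none).bind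
          fun w => decode w.2) =
      listColor (members (P.ids I) (S.lab (seed I)) x)
        (fun i => trunc s (partNbr (S.lab (seed I)) (nbr I i) i))
        (fun i => trunc s (partPal (S.lab (seed I)) (S.allow (seed I)) (col I) (nbr I i)
          (pal I i) i)) := by
    intro I x
    refine listColor_congr (fun i hi => ?_) fun i hi => ?_
    all_goals
      obtain ⟨hi, hli⟩ := mem_members.1 hi
      obtain ⟨u, rfl⟩ := exists_of_mem_ids hi
      refine gather_eq_trunc fun j hj => ?_
      rw [if_pos ⟨hli, hj⟩, Function.partialInv_left (P.ident_injective I), Option.map_some,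
        Option.bind_some]
      refine decode_encode fun c hc => ?_
    · exact hnbrD I _ c (Finset.mem_filter.1 (mem_of_nth? hc)).1
    · exact hpalD I _ c (mem_avail.1 (mem_partPal.1 (mem_of_nth? hc)).1).1
  let K (I : ι) (v : Fin n) :
      (LocalInput × Finset ℕ × σ × (ℕ → Option ℕ)) × Option (Fin D) :=
    (P.knowledge seed col I v, encode D (some
      (listColor (members (P.ids I) (S.lab (seed I)) (S.lab (seed I) (P.ident I v)))
        (fun i => trunc s (partNbr (S.lab (seed I)) (nbr I i) i))
        (fun i => trunc s (partPal (S.lab (seed I)) (S.allow (seed I)) (col I) (nbr I i)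
          (pal I i) i)) (P.ident I v))))
  have h3 := ((h2.map id (K' := fun I v => (P.knowledge seed col I v, fun i j =>
      if S.lab (seed I) i = rank (P.ids I) (P.ident I v) ∧ j < s then
        (Function.partialInv (P.ident I) i).map fun u => word I u j else none))
      fun I v => by simp only [knowledge, P.ownId_input, hnbr, hpal, word, id]).round
    -- Every processor answers as if it were the leader of the addressee; only the answer of the
    -- true leader is read.
    (μ := Option (Fin D)) (by simpa using hb') fun k i =>
      encode D (some (listColor (members k.1.2.1 (S.lab k.1.2.2.1) (S.lab k.1.2.2.1 i))
        (fun i' => gather s fun j => (k.2 i' j).bind fun w => decode w.1)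
        (fun i' => gather s fun j => (k.2 i' j).bind fun w => decode w.2) i))).map
    (K' := K)
    (fun k => (k.1.1, (k.2 (nth k.1.1.2.1 (S.lab k.1.1.2.2.1 k.1.1.1.ownId))).join))
    fun I v => Prod.ext rfl <| by
      have hlv : S.lab (seed I) (P.ident I v) < (P.ids I).card := by
        rw [card_ids]; exact hlab I _ (ident_mem_ids I v)
      obtain ⟨w, hw⟩ := exists_of_mem_ids (nth_mem hlv)
      have hrank : rank (P.ids I) (P.ident I w) = S.lab (seed I) (P.ident I v) := by
        rw [hw, rank_nth hlv]
      simp only [knowledge, P.ownId_input, K]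
      rw [← hw, received_ident]
      simp only [Option.join_some, hrank, hlist]
  have h4 := h3.round (μ := Option (Fin D)) (by simpa using hb') fun k _ => k.2
  refine h4.map (fun k => (k.1.1.1, k.1.1.2.1, k.1.1.2.2.1, fun i =>
    if i ∈ k.1.1.2.1 ∧ S.lev (S.lab k.1.1.2.2.1 i) = t then decode (k.2 i).join
    else k.1.1.2.2.2 i)) fun I v => ?_
  refine Prod.ext rfl (Prod.ext rfl (Prod.ext rfl (funext fun i => ?_)))
  change stageCol (P.ids I) (nbr I) (pal I) (S.lab (seed I)) S.lev (S.allow (seed I)) s t (col I) i =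
    if i ∈ P.ids I ∧ S.lev (S.lab (seed I) i) = t then
      decode (P.received K (fun k _ => k.2) I v i).join else col I i
  by_cases hi : i ∈ P.ids I ∧ S.lev (S.lab (seed I) i) = t
  swap
  · rw [if_neg hi, stageCol, if_neg hi]
  obtain ⟨u, rfl⟩ := exists_of_mem_ids hi.1
  have hval := hcol I (P.ident I u)
  rw [stageCol, if_pos hi] at hval
  rw [if_pos hi, received_ident, Option.join_some, decode_encode hval, stageCol, if_pos hi]

end Runs

/-! ### Publication of the seed and iteration over the levels. -/

theorem colAfter_of_notMem {ids : Finset ℕ} {nbr pal : ℕ → Finset ℕ} {lab lev : ℕ → ℕ}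
    {allow : ℕ → ℕ → Prop} {s i : ℕ} (hi : i ∉ ids) (t : ℕ) :
    colAfter ids nbr pal lab lev allow s t i = none := by
  induction t with
  | zero => rfl
  | succ t ih => rw [colAfter, stageCol, if_neg fun h => hi h.1, ih]

namespace Runs

variable {n : ℕ} {ι σ : Type} {P : Runs n ι}

theorem Computes.exists_output {b R : ℕ} {K : ι → Fin n → ℕ} (h : P.Computes b R K) :
    ∃ A : Algorithm b, ∀ I v,
      A.output (statesAfter A (P.ident I) (P.input I) (P.bits I) R v) = K I v := by
  obtain ⟨A, g, hg⟩ := h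
  let A' : Algorithm b := ⟨A.State, A.init, A.send, A.recv, g⟩
  have key : ∀ I t, statesAfter A' (P.ident I) (P.input I) (P.bits I) t =
      statesAfter A (P.ident I) (P.input I) (P.bits I) t := by
    intro I t
    induction t with
    | zero => rfl
    | succ t ih =>
      funext v
      rw [statesAfter, ih]
      rfl
  exact ⟨A', fun I v => by rw [key]; exact hg I v⟩

/-- One round to learn all the IDs and a seed that is drawn by the processor of smallest ID. -/
theorem computes_knowledge_none [Fintype σ] [Inhabited σ] {b : ℕ} (hb : Fintype.card σ ≤ 2 ^ b)
    (draw : (ℕ → Bool) → σ) {seed : ι → σ}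
    (hseed : ∀ I v, P.ident I v = sInf (P.ids I : Set ℕ) → seed I = draw (P.bits I v)) :
    P.Computes b 1 (P.knowledge seed fun _ _ => none) := by
  classical
  -- All processors send to everybody, so the support of the received function is exactly the set of
  -- IDs.
  let support (f : ℕ → Option σ) : Finset ℕ :=
    if h : {i | f i ≠ none}.Finite then h.toFinset else ∅
  refine ((P.computes_initial b).round hb fun k _ => draw k.2).map
    (fun k => (k.1.1, support k.2, (k.2 (sInf (support k.2 : Set ℕ))).getD default, fun _ => none))
    fun I v => ?_
  dsimp only
  set f := P.received (fun I v => (P.input I v, P.bits I v)) (fun k _ => draw k.2) I v with hf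
  have hmem : ∀ i, f i ≠ none ↔ i ∈ P.ids I := by
    intro i
    by_cases hi : i ∈ P.ids I
    · obtain ⟨u, rfl⟩ := exists_of_mem_ids hi
      simp [hf, received_ident, hi]
    · simp [hf, received, partialInv_eq_none hi, hi]
  have hset : {i | f i ≠ none} = (P.ids I : Set ℕ) := Set.ext fun i => by simpa using hmem i
  have hfin : {i | f i ≠ none}.Finite := hset ▸ (P.ids I).finite_toSet
  have hsupp : support f = P.ids I := by
    simp only [support, dif_pos hfin]
    ext i
    simpa using hmem i
  obtain ⟨w, hw⟩ := exists_of_mem_ids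
    (Nat.sInf_mem (s := (P.ids I : Set ℕ)) ⟨_, ident_mem_ids I v⟩)
  refine Prod.ext rfl (Prod.ext hsupp.symm (Prod.ext ?_ rfl))
  dsimp only [knowledge]
  rw [hsupp, ← hw, hf, received_ident]
  exact hseed I w hw

theorem computes_colAfter [Fintype σ] [Inhabited σ] {b C D s T : ℕ} (S : Scheme σ)
    {seed : ι → σ} (hσ : Fintype.card σ ≤ 2 ^ b) (draw : (ℕ → Bool) → σ)
    (hseed : ∀ I v, P.ident I v = sInf (P.ids I : Set ℕ) → seed I = draw (P.bits I v))
    {nbr pal : ι → ℕ → Finset ℕ}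
    (hnbr : ∀ I v, (P.input I v).nbrIds = nbr I (P.ident I v))
    (hpal : ∀ I v, (P.input I v).palette = pal I (P.ident I v))
    (hnbrD : ∀ I i, ∀ j ∈ nbr I i, j < D) (hpalD : ∀ I i, ∀ c ∈ pal I i, c < D)
    (hb : ((D + 1) * (D + 1)) ^ C ≤ 2 ^ b) (hb' : D + 1 ≤ 2 ^ b)
    (hload : ∀ I x, (members (P.ids I) (S.lab (seed I)) x).card * s ≤ C * n)
    (hlab : ∀ I, ∀ i ∈ P.ids I, S.lab (seed I) i < n)
    (hcol : ∀ I t i c, colAfter (P.ids I) (nbr I) (pal I) (S.lab (seed I)) S.lev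
      (S.allow (seed I)) s t i = some c → c < D) :
    P.Computes b (1 + 4 * T) (P.knowledge seed fun I => colAfter (P.ids I) (nbr I) (pal I)
      (S.lab (seed I)) S.lev (S.allow (seed I)) s T) := by
  induction T with
  | zero => exact computes_knowledge_none hσ draw hseed
  | succ T ih =>
    exact ih.stage S hnbr hpal hnbrD hpalD hb hb' hload hlab fun I i c => hcol I (T + 1) i c

end Runs

/-! ### List coloring instances and good seeds. -/

section Instances

variable {n : ℕ}

/-- The IDs of the neighbors of the vertex with ID `i`. -/
noncomputable def nbrOf (G : SimpleGraph (Fin n)) [DecidableRel G.Adj] (ident : Fin n → ℕ) (i : ℕ) :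
    Finset ℕ :=
  (Function.partialInv ident i).elim ∅ fun v => (G.neighborFinset v).image ident

/-- The palette of the vertex with ID `i`. -/
noncomputable def palOf (Ψ : Fin n → Finset ℕ) (ident : Fin n → ℕ) (i : ℕ) : Finset ℕ :=
  (Function.partialInv ident i).elim ∅ Ψ

variable (G : SimpleGraph (Fin n)) [DecidableRel G.Adj] {ident : Fin n → ℕ}

theorem nbrOf_ident (hid : Function.Injective ident) (v : Fin n) :
    nbrOf G ident (ident v) = (G.neighborFinset v).image ident := by
  simp [nbrOf, Function.partialInv_left hid]

theorem palOf_ident (Ψ : Fin n → Finset ℕ) (hid : Function.Injective ident) (v : Fin n) :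
    palOf Ψ ident (ident v) = Ψ v := by
  simp [palOf, Function.partialInv_left hid]

theorem partialInv_eq_some (hid : Function.Injective ident) {i : ℕ} {v : Fin n}
    (h : Function.partialInv ident i = some v) : ident v = i :=
  (hid.isPartialInv v i).1 h

theorem mem_nbrOf (hid : Function.Injective ident) {i j : ℕ} :
    j ∈ nbrOf G ident i ↔ ∃ u v, G.Adj u v ∧ ident u = i ∧ ident v = j := by
  constructor
  · intro h
    cases hu : Function.partialInv ident i with
    | none => simp [nbrOf, hu] at h
    | some u =>
      obtain ⟨v, hv, rfl⟩ := by simpa [nbrOf, hu] using h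
      exact ⟨u, v, hv, partialInv_eq_some hid hu, rfl⟩
  · rintro ⟨u, v, huv, rfl, rfl⟩
    rw [nbrOf_ident G hid]
    exact Finset.mem_image_of_mem _ (by simpa using huv)

/-- The seed `r` gives a scheme that works well for the instance: the leaders can receive all
the information about their parts, and the vertices have more colors available than neighbors
within their parts. -/
structure Scheme.Good {σ : Type} (S : Scheme σ) (r : σ) (T C s : ℕ) (ids : Finset ℕ)
    (nbr pal : ℕ → Finset ℕ) : Prop where
  lab_lt : ∀ i ∈ ids, S.lab r i < ids.card
  lev_lt : ∀ i ∈ ids, S.lev (S.lab r i) < T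
  load : ∀ x, (members ids (S.lab r) x).card * s ≤ C * ids.card
  deg : ∀ i ∈ ids, (partNbr (S.lab r) (nbr i) i).card < s
  colors : ∀ i ∈ ids, (partNbr (S.lab r) (nbr i) i).card <
    (partPal (S.lab r) (S.allow r) (colAfter ids nbr pal (S.lab r) S.lev (S.allow r) s
      (S.lev (S.lab r i))) (nbr i) (pal i) i).card

open Classical in
/-- An execution on a list coloring instance with IDs and colors less than `D`, in which the seed
drawn by the vertex of smallest ID is good. -/
structure GoodRun {σ : Type} (S : Scheme σ) (draw : (ℕ → Bool) → σ) (n T C D s : ℕ) where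
  G : SimpleGraph (Fin n)
  ident : Fin n → ℕ
  ident_injective : Function.Injective ident
  ident_lt : ∀ v, ident v < D
  Ψ : Fin n → Finset ℕ
  palette_lt : ∀ v, ∀ c ∈ Ψ v, c < D
  bits : Fin n → ℕ → Bool
  leader : Fin n
  leader_eq : ident leader = sInf (Finset.univ.image ident : Set ℕ)
  good : S.Good (draw (bits leader)) T C s (Finset.univ.image ident) (nbrOf G ident) (palOf Ψ ident)

open Classical in
/-- The good executions as a family. -/
noncomputable def goodRuns {σ : Type} (S : Scheme σ) (draw : (ℕ → Bool) → σ) (n T C D s : ℕ) :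
    Runs n (GoodRun S draw n T C D s) where
  ident I := I.ident
  ident_injective I := I.ident_injective
  input I := localInput I.G I.ident I.Ψ
  bits I := I.bits
  ownId_input _ _ := rfl

/-- The coloring algorithm of a scheme succeeds if the seed is good. -/
theorem Scheme.exists_algorithm {σ : Type} [Fintype σ] [Inhabited σ] (S : Scheme σ)
    (hdisj : ∀ r x y c, S.lev x = S.lev y → S.allow r x c → S.allow r y c → x = y)
    (draw : (ℕ → Bool) → σ) {b T C D s : ℕ} (hσ : Fintype.card σ ≤ 2 ^ b)
    (hb : ((D + 1) * (D + 1)) ^ C ≤ 2 ^ b) (hb' : D + 1 ≤ 2 ^ b) :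
    ∃ A : Algorithm b, ∀ (G : SimpleGraph (Fin n)) [DecidableRel G.Adj] (ident : Fin n → ℕ),
      Function.Injective ident → (∀ v, ident v < D) → ∀ Ψ : Fin n → Finset ℕ,
      (∀ v, ∀ c ∈ Ψ v, c < D) → ∀ (ω : Fin n → ℕ → Bool) (leader : Fin n),
      ident leader = sInf (Finset.univ.image ident : Set ℕ) →
      S.Good (draw (ω leader)) T C s (Finset.univ.image ident) (nbrOf G ident) (palOf Ψ ident) →
      IsListColoring G Ψ (result A (1 + 4 * T) G ident Ψ ω) := by
  classical
  set P := goodRuns S draw n T C D s with hP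
  let seed (I : GoodRun S draw n T C D s) : σ := draw (I.bits I.leader)
  let nbr (I : GoodRun S draw n T C D s) := nbrOf I.G I.ident
  let pal (I : GoodRun S draw n T C D s) := palOf I.Ψ I.ident
  have hpalD : ∀ I i, ∀ c ∈ pal I i, c < D := by
    intro I i c hc
    cases hu : Function.partialInv I.ident i with
    | none => simp [pal, palOf, hu] at hc
    | some u => exact I.palette_lt u c (by simpa [pal, palOf, hu] using hc)
  have hcolored : ∀ I, ∀ i ∈ P.ids I, ∃ c ∈ pal I i,
      colAfter (P.ids I) (nbr I) (pal I) (S.lab (seed I)) S.lev (S.allow (seed I)) s T i = some c ∧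
      ∀ j ∈ nbr I i, colAfter (P.ids I) (nbr I) (pal I) (S.lab (seed I)) S.lev (S.allow (seed I))
        s T j ≠ some c := by
    intro I i hi
    refine exists_colAfter (fun i j hj => ?_) (fun i j hj => ?_) (fun i hi => ?_)
      (hdisj (seed I)) I.good.deg I.good.colors I.good.lev_lt hi
    · obtain ⟨u, v, -, -, rfl⟩ := (mem_nbrOf I.G I.ident_injective).1 hj
      exact Runs.ident_mem_ids (P := P) I v
    · obtain ⟨u, v, h, h1, h2⟩ := (mem_nbrOf I.G I.ident_injective).1 hj
      exact (mem_nbrOf I.G I.ident_injective).2 ⟨v, u, h.symm, h2, h1⟩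
    · obtain ⟨u, v, h, h1, h2⟩ := (mem_nbrOf I.G I.ident_injective).1 hi
      exact h.ne (I.ident_injective (h1.trans h2.symm))
  have hcard : ∀ I : GoodRun S draw n T C D s, (Finset.univ.image I.ident).card = n := Runs.card_ids (P := P)
  have h := Runs.computes_colAfter (P := P) (C := C) (D := D) (s := s) (T := T) (nbr := nbr)
    (pal := pal) S (seed := seed) hσ draw
    (fun I v hv => by rw [I.ident_injective (hv.trans I.leader_eq.symm)]; rfl)
    (fun I v => (nbrOf_ident I.G I.ident_injective v).symm)
    (fun I v => (palOf_ident I.Ψ I.ident_injective v).symm)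
    (fun I i j hj => by
      obtain ⟨u, v, -, -, rfl⟩ := (mem_nbrOf I.G I.ident_injective).1 hj
      exact I.ident_lt v)
    hpalD hb hb'
    (fun I x => (I.good.load x).trans_eq (by rw [hcard]))
    (fun I i hi => (I.good.lab_lt i hi).trans_eq (hcard I))
    -- Vertices are never recolored, so an intermediate color is the final one and belongs to the
    -- palette; it therefore fits into a message.
    (fun I t i c hc => by
      by_cases hi : i ∈ P.ids I
      · obtain ⟨d, hd, hd', -⟩ := hcolored I i hi
        rcases le_or_gt t (S.lev (S.lab (seed I) i)) with ht | ht
        · rw [colAfter_of_le ht] at hc; cases hc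
        · rw [colAfter_of_lt (I.good.lev_lt i hi), ← colAfter_of_lt ht, hc] at hd'
          cases hd'
          exact hpalD I i c hd
      · rw [colAfter_of_notMem hi] at hc; cases hc)
  obtain ⟨A, hA⟩ := (h.map (K' := fun I v => (colAfter (P.ids I) (nbr I) (pal I) (S.lab (seed I))
    S.lev (S.allow (seed I)) s T (I.ident v)).getD 0) (fun k => (k.2.2.2 k.1.ownId).getD 0)
    fun I v => rfl).exists_output
  refine ⟨A, fun G inst ident hid hidD Ψ hΨ ω leader hleader hgood => ?_⟩
  let I : GoodRun S draw n T C D s :=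
    ⟨G, ident, hid, hidD, Ψ, hΨ, ω, leader, hleader, by convert hgood⟩
  have hres : ∀ v, result A (1 + 4 * T) G ident Ψ ω v = (colAfter (P.ids I) (nbr I) (pal I)
      (S.lab (seed I)) S.lev (S.allow (seed I)) s T (ident v)).getD 0 := by
    intro v
    rw [← hA I v]
    have hinput : localInput G ident Ψ = P.input I := by
      simp only [hP, goodRuns, I]
      congr!
    rw [result, hinput]
    rfl
  refine ⟨fun v => ?_, fun u v huv => ?_⟩
  · obtain ⟨c, hc, hc', -⟩ := hcolored I _ (Runs.ident_mem_ids (P := P) I v)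
    rw [hres, show ident v = P.ident I v from rfl, hc', Option.getD_some]
    exact (palOf_ident Ψ hid v) ▸ hc
  · obtain ⟨c, hc, hc', hcn⟩ := hcolored I _ (Runs.ident_mem_ids (P := P) I u)
    obtain ⟨d, hd, hd', -⟩ := hcolored I _ (Runs.ident_mem_ids (P := P) I v)
    have := hcn (ident v) ((@mem_nbrOf n G (fun _ _ => Classical.propDecidable _) ident hid
      (ident u) (ident v)).2 ⟨u, v, huv, rfl, rfl⟩)
    rw [hres, hres, show ident u = P.ident I u from rfl, show ident v = P.ident I v from rfl, hc',
      hd', Option.getD_some, Option.getD_some]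
    rintro rfl
    exact this hd'

end Instances

/-! ### Concentration and small hash families. -/

section Hashing

open Finset

/-- The exponential moment factors over the independent keys; each key of `S` contributes a factor
of the form `1 + x ≤ exp x`. -/
theorem sum_exp_card_le {α β : Type*} [Fintype α] [DecidableEq α] [Fintype β] [DecidableEq β]
    [Nonempty β] (S : Finset α) (T : Finset β) (θ : ℝ) :
    ∑ h : α → β, Real.exp (θ * #{i ∈ S | h i ∈ T}) ≤
      (Fintype.card β : ℝ) ^ Fintype.card α *
        Real.exp (#S * #T / Fintype.card β * (Real.exp θ - 1)) := by
  have hβ : (0 : ℝ) < Fintype.card β := by exact_mod_cast Fintype.card_pos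
  have hprod : ∀ h : α → β, Real.exp (θ * #{i ∈ S | h i ∈ T}) =
      ∏ i, if i ∈ S ∧ h i ∈ T then Real.exp θ else 1 := by
    intro h
    rw [prod_ite, prod_const, prod_const_one, mul_one, mul_comm, Real.exp_nat_mul]
    congr 2
    ext i
    simp
  have hsum : ∀ i, ∑ x : β, (if i ∈ S ∧ x ∈ T then Real.exp θ else 1) ≤
      Fintype.card β * if i ∈ S then Real.exp (#T / Fintype.card β * (Real.exp θ - 1)) else 1 := by
    intro i
    by_cases hi : i ∈ S
    · simp only [hi, true_and, if_true]
      have h1 : ∑ x : β, (if x ∈ T then Real.exp θ else 1) =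
          Fintype.card β * (#T / Fintype.card β * (Real.exp θ - 1) + 1) := by
        have : ∀ x : β, (if x ∈ T then Real.exp θ else 1) =
            (if x ∈ T then Real.exp θ - 1 else 0) + 1 := by
          intro x; split_ifs <;> ring
        simp_rw [this]
        rw [sum_add_distrib, sum_ite_mem, univ_inter, sum_const, sum_const, nsmul_eq_mul,
          nsmul_eq_mul, card_univ]
        field_simp
      rw [h1]
      exact mul_le_mul_of_nonneg_left (Real.add_one_le_exp _) hβ.le
    · simp [hi]
  simp_rw [hprod]
  have := prod_univ_sum (fun _ : α => (univ : Finset β))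
    (fun i x => if i ∈ S ∧ x ∈ T then Real.exp θ else (1 : ℝ))
  rw [Fintype.piFinset_univ] at this
  rw [← this]
  refine (prod_le_prod (fun i _ => sum_nonneg fun x _ => by split_ifs <;> positivity)
    fun i _ => hsum i).trans_eq ?_
  rw [prod_mul_distrib, prod_const, card_univ, prod_ite_mem, univ_inter, prod_const,
    ← Real.exp_nat_mul]
  congr 2
  ring

/-- The number of elements of `S` whose hash value is in `T` is far from its expectation, for
hash values in a range of size `w`. -/
def Deviates (κ : ℝ) (w : ℕ) (h : ℕ → ℕ) (S T : Finset ℕ) : Prop :=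
  κ ^ 2 * max (#S * #T / w : ℝ) (κ ^ 2) < (#{i ∈ S | h i ∈ T} - #S * #T / w : ℝ) ^ 2

open Classical in
/-- Chernoff's bound for random functions. -/
theorem card_deviates_le {α β : Type*} [Fintype α] [DecidableEq α] [Fintype β] [DecidableEq β]
    [Nonempty β] (S : Finset α) (T : Finset β) {κ : ℝ} (hκ : 0 < κ) :
    (#{h : α → β | κ ^ 2 * max (#S * #T / Fintype.card β : ℝ) (κ ^ 2) <
      (#{i ∈ S | h i ∈ T} - #S * #T / Fintype.card β : ℝ) ^ 2} : ℝ) ≤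
      2 * Real.exp (-κ ^ 2 / 4) * (Fintype.card β : ℝ) ^ Fintype.card α := by
  set μ : ℝ := #S * #T / Fintype.card β with hμ
  set X : (α → β) → ℝ := fun h => #{i ∈ S | h i ∈ T} with hX
  have hμ0 : 0 ≤ μ := by positivity
  set σ := max μ (κ ^ 2) with hσ
  have hσ0 : 0 < σ := lt_max_of_lt_right (by positivity)
  set r := √σ with hr
  have hr0 : 0 < r := Real.sqrt_pos.2 hσ0
  have hrr : r ^ 2 = σ := Real.sq_sqrt hσ0.le
  have hκr : κ ≤ r := Real.le_sqrt_of_sq_le (le_max_right _ _)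
  -- This optimizes `σ * θ ^ 2 - θ * κ * r`, whose minimum is `-κ ^ 2 / 4`. Taking `max μ (κ ^ 2)`
  -- as `σ` keeps `θ ≤ 1`, where `|exp η - 1 - η| ≤ η ^ 2` is available.
  set θ := κ / (2 * r) with hθ
  have hθ0 : 0 < θ := by positivity
  have hθ1 : θ ≤ 1 := by rw [hθ, div_le_one (by positivity)]; linarith
  have hθr : θ * r = κ / 2 := by rw [hθ]; field_simp
  have hexp : ∀ η : ℝ, |η| = θ → ∑ h, Real.exp (η * (X h - μ) - θ * (κ * r)) ≤
      Real.exp (-κ ^ 2 / 4) * (Fintype.card β : ℝ) ^ Fintype.card α := by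
    intro η hη
    have h1 : ∀ h, Real.exp (η * (X h - μ) - θ * (κ * r)) =
        Real.exp (-(η * μ) - θ * (κ * r)) * Real.exp (η * X h) := by
      intro h; rw [← Real.exp_add]; congr 1; ring
    simp_rw [h1]
    rw [← mul_sum]
    refine (mul_le_mul_of_nonneg_left (sum_exp_card_le S T η) (Real.exp_pos _).le).trans ?_
    rw [mul_left_comm, ← Real.exp_add, mul_comm]
    refine mul_le_mul_of_nonneg_right (Real.exp_le_exp.2 ?_) (by positivity)
    have h2 := (abs_le.1 (Real.abs_exp_sub_one_sub_id_le (x := η) (hη.trans_le hθ1))).2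
    have h3 : η ^ 2 = θ ^ 2 := by rw [← hη, sq_abs]
    have h4 : μ * (Real.exp η - 1 - η) ≤ σ * θ ^ 2 := by
      rw [h3] at h2
      exact (mul_le_mul_of_nonneg_left h2 hμ0).trans
        (mul_le_mul_of_nonneg_right (le_max_left _ _) (by positivity))
    have h5 : σ * θ ^ 2 = κ ^ 2 / 4 := by
      rw [← hrr, ← mul_pow, mul_comm, hθr]; ring
    have h6 : θ * (κ * r) = κ ^ 2 / 2 := by rw [mul_left_comm, hθr]; ring
    rw [← hμ, h6]
    linarith
  have hind : ∀ h, (if κ ^ 2 * σ < (X h - μ) ^ 2 then (1 : ℝ) else 0) ≤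
      Real.exp (θ * (X h - μ) - θ * (κ * r)) + Real.exp (-θ * (X h - μ) - θ * (κ * r)) := by
    intro h
    split_ifs with hd
    · rw [← hrr, ← mul_pow] at hd
      have := abs_lt_of_sq_lt_sq' (a := κ * r) (b := |X h - μ|) (by rwa [sq_abs]) (abs_nonneg _)
      rcases le_total 0 (X h - μ) with h0 | h0
      · rw [abs_of_nonneg h0] at this
        have : 1 ≤ Real.exp (θ * (X h - μ) - θ * (κ * r)) :=
          Real.one_le_exp (by nlinarith [this.2])
        linarith [Real.exp_pos (-θ * (X h - μ) - θ * (κ * r))]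
      · rw [abs_of_nonpos h0] at this
        have : 1 ≤ Real.exp (-θ * (X h - μ) - θ * (κ * r)) :=
          Real.one_le_exp (by nlinarith [this.2])
        linarith [Real.exp_pos (θ * (X h - μ) - θ * (κ * r))]
    · positivity
  rw [← sum_boole]
  refine (sum_le_sum fun h _ => hind h).trans ?_
  rw [sum_add_distrib]
  have h1 := hexp θ (abs_of_pos hθ0)
  have h2 := hexp (-θ) (by rw [abs_neg, abs_of_pos hθ0])
  linarith

open Classical in
/-- If each of the properties `Bad j` is improbable then there is a list of samples, of length
logarithmic in the number of the properties, in which each of them is rare. -/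
theorem exists_samples {Ω σ J : Type*} [Fintype Ω] [Nonempty Ω] [Fintype σ] [Fintype J]
    (Bad : J → Ω → Prop) {p : ℝ} (hbad : ∀ j, (#{x | Bad j x} : ℝ) ≤ p * Fintype.card Ω)
    (hJ : (Fintype.card J : ℝ) ≤ Real.exp (p * Fintype.card σ)) :
    ∃ f : σ → Ω, ∀ j, (#{s | Bad j (f s)} : ℝ) ≤ 4 * p * Fintype.card σ := by
  by_contra! hcon
  set M : ℝ := (Fintype.card σ : ℝ) with hM
  have hΩ : (0 : ℝ) < Fintype.card Ω := by exact_mod_cast Fintype.card_pos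
  have hJ1 : (1 : ℝ) ≤ Fintype.card J := by
    obtain ⟨j, -⟩ := hcon fun _ => Classical.arbitrary Ω
    exact_mod_cast Fintype.card_pos_iff.2 ⟨j⟩
  have hpM : 0 ≤ p * M := Real.one_le_exp_iff.1 (hJ1.trans hJ)
  have hlog : (1 / 2 : ℝ) < Real.log 2 := by linarith [Real.log_two_gt_d9]
  -- If some property is hit more than `4 * p * M` times, then `2` to the number of hits exceeds
  -- `exp (2 * (p * M))`. On average this power is at most `exp (p * M)` for each property, and
  -- there are at most `exp (p * M)` properties.
  have hlow : ∀ f : σ → Ω, Real.exp (2 * (p * M)) <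
      ∑ j, ∏ s, if Bad j (f s) then (2 : ℝ) else 1 := by
    intro f
    obtain ⟨j, hj⟩ := hcon f
    refine lt_of_lt_of_le ?_ (single_le_sum
      (f := fun j => ∏ s, if Bad j (f s) then (2 : ℝ) else 1)
      (fun j _ => prod_nonneg fun s _ => by split_ifs <;> norm_num) (mem_univ j))
    rw [prod_ite, prod_const, prod_const_one, mul_one, ← Real.exp_log (two_pos (α := ℝ)),
      ← Real.exp_nat_mul, Real.exp_log two_pos]
    refine Real.exp_lt_exp.2 ?_
    nlinarith
  have hup : ∀ j, ∑ f : σ → Ω, ∏ s, (if Bad j (f s) then (2 : ℝ) else 1) ≤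
      (Fintype.card Ω : ℝ) ^ Fintype.card σ * Real.exp (p * M) := by
    intro j
    have := prod_univ_sum (fun _ : σ => (univ : Finset Ω))
      (fun _ x => if Bad j x then (2 : ℝ) else 1)
    rw [Fintype.piFinset_univ] at this
    rw [← this, prod_const, card_univ]
    have h1 : ∑ x, (if Bad j x then (2 : ℝ) else 1) ≤ Fintype.card Ω * Real.exp p := by
      have : ∀ x, (if Bad j x then (2 : ℝ) else 1) = (if Bad j x then 1 else 0) + 1 := by
        intro x; split_ifs <;> norm_num
      simp_rw [this]
      rw [sum_add_distrib, sum_boole, sum_const, card_univ, nsmul_eq_mul, mul_one]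
      nlinarith [hbad j, Real.add_one_le_exp p]
    refine (pow_le_pow_left₀ (sum_nonneg fun x _ => by split_ifs <;> norm_num) h1 _).trans_eq ?_
    rw [mul_pow, ← Real.exp_nat_mul, mul_comm p M]
  have hlow' : (Fintype.card Ω : ℝ) ^ Fintype.card σ * Real.exp (2 * (p * M)) <
      ∑ f : σ → Ω, ∑ j, ∏ s, if Bad j (f s) then (2 : ℝ) else 1 := by
    have := sum_lt_sum_of_nonempty (s := (univ : Finset (σ → Ω))) univ_nonempty fun f _ => hlow f
    rwa [sum_const, card_univ, Fintype.card_fun, nsmul_eq_mul, Nat.cast_pow] at this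
  rw [sum_comm] at hlow'
  have hup' := sum_le_sum fun j (_ : j ∈ (univ : Finset J)) => hup j
  rw [sum_const, card_univ, nsmul_eq_mul] at hup'
  have : (Fintype.card J : ℝ) * ((Fintype.card Ω : ℝ) ^ Fintype.card σ * Real.exp (p * M)) ≤
      (Fintype.card Ω : ℝ) ^ Fintype.card σ * Real.exp (2 * (p * M)) := by
    rw [mul_left_comm]
    refine mul_le_mul_of_nonneg_left ?_ (by positivity)
    rw [two_mul, Real.exp_add]
    exact mul_le_mul_of_nonneg_right hJ (Real.exp_pos _).le
  linarith

open Classical in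
/-- A small family of hash functions: for every set `S` of keys and every set `T` of values, the
number of keys in `S` with value in `T` is close to the expectation for most of the functions. -/
theorem exists_hashFamily (σ : Type*) [Fintype σ] (D : ℕ) {w : ℕ} (hw : 0 < w) {κ p : ℝ}
    (hκ : 0 < κ) (hp : 2 * Real.exp (-κ ^ 2 / 4) ≤ p)
    (hD : (2 : ℝ) ^ (D + w) ≤ Real.exp (p * Fintype.card σ)) :
    ∃ h : σ → ℕ → ℕ, (∀ s i, h s i < w) ∧ ∀ S ⊆ range D, ∀ T ⊆ range w,
      (#{s | Deviates κ w (h s) S T} : ℝ) ≤ 4 * p * Fintype.card σ := by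
  have : Nonempty (Fin w) := ⟨⟨0, hw⟩⟩
  obtain ⟨f, hf⟩ := exists_samples (σ := σ) (Ω := Fin D → Fin w)
    -- All `2 ^ (D + w)` pairs are handled at once, so sets that depend on the input or on earlier
    -- random choices are covered too.
    (J := Finset (Fin D) × Finset (Fin w)) (p := p)
    (fun j h => κ ^ 2 * max (#j.1 * #j.2 / Fintype.card (Fin w) : ℝ) (κ ^ 2) <
      (#{i ∈ j.1 | h i ∈ j.2} - #j.1 * #j.2 / Fintype.card (Fin w) : ℝ) ^ 2)
    (fun j => by
      refine (card_deviates_le j.1 j.2 hκ).trans ?_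
      rw [Fintype.card_fun, Nat.cast_pow]
      exact mul_le_mul_of_nonneg_right hp (by positivity))
    (by simpa [pow_add] using hD)
  refine ⟨fun s i => if hi : i < D then f s ⟨i, hi⟩ else 0, fun s i => ?_, fun S hS T hT => ?_⟩
  · dsimp only
    split_ifs
    · exact Fin.is_lt _
    · exact hw
  have hST : ∀ {k : ℕ} {A : Finset ℕ}, A ⊆ range k →
      A = ({i : Fin k | (i : ℕ) ∈ A} : Finset (Fin k)).map Fin.valEmbedding := by
    intro k A hA
    ext i
    simp only [mem_map, mem_filter, mem_univ, true_and, Fin.valEmbedding_apply]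
    exact ⟨fun h => ⟨⟨i, mem_range.1 (hA h)⟩, h, rfl⟩, by rintro ⟨j, hj, rfl⟩; exact hj⟩
  refine (le_of_eq ?_).trans (hf (({i : Fin D | (i : ℕ) ∈ S} : Finset (Fin D)),
    ({x : Fin w | (x : ℕ) ∈ T} : Finset (Fin w))))
  congr 2
  ext s
  simp only [mem_filter, mem_univ, true_and, Deviates, Fintype.card_fin]
  have hS' := congrArg card (hST hS)
  have hT' := congrArg card (hST hT)
  rw [card_map] at hS' hT'
  rw [← hS', ← hT']
  have : #{i ∈ S | (if hi : i < D then (f s ⟨i, hi⟩ : ℕ) else 0) ∈ T} =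
      #{i ∈ ({i : Fin D | (i : ℕ) ∈ S} : Finset (Fin D)) | ((f s i : Fin w) : ℕ) ∈ T} := by
    conv_lhs => rw [hST hS]
    rw [filter_map, card_map]
    congr 1
    ext i
    simp
  rw [this]

end Hashing

/-! ### Resampling one coordinate, and the law of the coins. -/

open Finset in
open Classical in
theorem card_filter_apply_le {ν τ : Type*} [Fintype ν] [DecidableEq ν] [Fintype τ] (t : ν)
    (Bad : τ → (ν → τ) → Prop) (hBad : ∀ x r y, Bad x (Function.update r t y) ↔ Bad x r) {q : ℝ}
    (hq : ∀ r, (#{x | Bad x r} : ℝ) ≤ q * Fintype.card τ) :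
    (#{r : ν → τ | Bad (r t) r} : ℝ) ≤ q * Fintype.card (ν → τ) := by
  rcases isEmpty_or_nonempty τ with hτ | hτ
  · have : IsEmpty (ν → τ) := ⟨fun r => hτ.elim (r t)⟩
    simp
  have hτ' : (0 : ℝ) < Fintype.card τ := by exact_mod_cast Fintype.card_pos
  -- Exchanging the drawn coordinate with a fresh one is a bijection that preserves the event,
  -- because `Bad x` ignores coordinate `t`.
  let e : (ν → τ) × τ → (ν → τ) × τ := fun z => (Function.update z.1 t z.2, z.1 t)
  have he : Function.Involutive e := fun z => by simp [e]
  have h1 : ∑ z : (ν → τ) × τ, (if Bad (z.1 t) z.1 then (1 : ℝ) else 0) =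
      ∑ z : (ν → τ) × τ, if Bad z.2 z.1 then (1 : ℝ) else 0 := by
    refine Fintype.sum_equiv he.toPerm _ _ fun z => ?_
    simp [e, hBad]
  rw [Fintype.sum_prod_type, Fintype.sum_prod_type] at h1
  have h2 : ∀ r : ν → τ, ∑ _x : τ, (if Bad (r t) r then (1 : ℝ) else 0) =
      Fintype.card τ * if Bad (r t) r then 1 else 0 := fun r => by
    rw [sum_const, card_univ, nsmul_eq_mul]
  rw [sum_congr rfl fun r _ => h2 r, ← mul_sum, sum_boole] at h1
  refine le_of_mul_le_mul_left ?_ hτ'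
  rw [h1, sum_congr rfl fun r _ => sum_boole _ _]
  refine (sum_le_sum fun r _ => hq r).trans_eq ?_
  rw [sum_const, card_univ, nsmul_eq_mul]
  ring

theorem fairCoin_singleton (x : Bool) : fairCoin {x} = 2⁻¹ := by
  rw [fairCoin, PMF.toMeasure_apply_singleton _ _ (MeasurableSet.singleton x),
    PMF.uniformOfFintype_apply]
  simp

instance : IsProbabilityMeasure fairCoin := by
  unfold fairCoin; infer_instance

theorem coins_cylinder {n : ℕ} (v : Fin n) {κ : Type*} [Fintype κ] {e : κ → ℕ}
    (he : Function.Injective e) (f : κ → Bool) :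
    coins n {ω | ∀ i, ω v (e i) = f i} = 2⁻¹ ^ Fintype.card κ := by
  classical
  have hset : {ω : Fin n → ℕ → Bool | ∀ i, ω v (e i) = f i} = Function.eval v ⁻¹'
      Set.pi (Finset.univ.map ⟨e, he⟩) fun x => {Function.extend e f (fun _ => false) x} := by
    ext ω
    simp [Set.mem_pi, he.extend_apply]
  have hmeas : MeasurableSet (Set.pi ((Finset.univ.map ⟨e, he⟩ : Finset ℕ) : Set ℕ)
      fun x => ({Function.extend e f (fun _ => false) x} : Set Bool)) :=
    MeasurableSet.pi (Finset.countable_toSet _) fun _ _ => MeasurableSet.singleton _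
  rw [hset, coins, (measurePreserving_eval (fun _ : Fin n =>
    Measure.infinitePi fun _ : ℕ => fairCoin) v).measure_preimage hmeas.nullMeasurableSet,
    Measure.infinitePi_pi _ fun _ _ => MeasurableSet.singleton _]
  simp [fairCoin_singleton]

open Finset in
theorem coins_le {n : ℕ} (v : Fin n) {κ : Type*} [Fintype κ] [DecidableEq κ] {e : κ → ℕ}
    (he : Function.Injective e) (B : Finset (κ → Bool)) {d : ℕ}
    (hB : (#B : ℝ) * (n : ℝ) ^ d ≤ 2 ^ Fintype.card κ) :
    coins n {ω | (fun i => ω v (e i)) ∈ B} ≤ 1 / (n : ℝ≥0∞) ^ d := by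
  have hn : (n : ℝ≥0∞) ≠ 0 := by exact_mod_cast (Fin.pos v).ne'
  have hset : {ω : Fin n → ℕ → Bool | (fun i => ω v (e i)) ∈ B} ⊆
      ⋃ f ∈ B, {ω | ∀ i, ω v (e i) = f i} := fun ω hω => by
    simp only [Set.mem_iUnion]
    exact ⟨_, hω, fun i => rfl⟩
  refine (measure_mono hset).trans ((measure_biUnion_finset_le _ _).trans ?_)
  simp_rw [coins_cylinder v he]
  rw [sum_const, nsmul_eq_mul, ENNReal.le_div_iff_mul_le (Or.inl (pow_ne_zero _ hn))
    (Or.inl (ENNReal.pow_ne_top (ENNReal.natCast_ne_top n))), mul_right_comm,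
    ← ENNReal.inv_pow, ← div_eq_mul_inv]
  refine ENNReal.div_le_of_le_mul ?_
  rw [one_mul]
  exact_mod_cast hB

/-! ### The layered scheme. -/

section Layered

open Finset

/-- The level of a label: `0, …, m ^ 4 - 1` are the labels, and those below `m ^ (4 - t)` have
level at least `t`. -/
def level (m x : ℕ) : ℕ :=
  if x < 1 then 4 else if x < m then 3 else if x < m ^ 2 then 2 else if x < m ^ 3 then 1 else 0

theorem level_le (m x : ℕ) : level m x ≤ 4 := by
  unfold level; split_ifs <;> omega

theorem le_level_iff {m x t : ℕ} (hm : 1 ≤ m) (ht : t ≤ 4) (hx : x < m ^ 4) :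
    t ≤ level m x ↔ x < m ^ (4 - t) := by
  have h1 : m ≤ m ^ 2 := Nat.le_self_pow (by norm_num) m
  have h2 : m ^ 2 ≤ m ^ 3 := Nat.pow_le_pow_right hm (by norm_num)
  unfold level
  interval_cases t <;> simp only [Nat.sub_self, Nat.sub_zero, pow_zero, Nat.reduceSub, pow_one] <;>
    split_ifs <;> omega

/-- The scheme in which the labels are hash values of the IDs, and a color is allowed in a part of
level less than `4` if a hash value of the color is the label of the part. -/
def layered {τ : Type} (m : ℕ) (X : τ → ℕ → ℕ) (H : Fin 4 → τ → ℕ → ℕ) : Scheme (Fin 5 → τ) where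
  lab r := X (r (Fin.last 4))
  lev := level m
  -- The offset shifts hash values to the interval of labels of level `t`. On level `4` the
  -- condition is vacuous and every color is allowed.
  allow r x c := ∀ t : Fin 4, level m x = t → H t (r t.castSucc) c + m ^ (3 - (t : ℕ)) = x

theorem layered_disjoint {τ : Type} (m : ℕ) (X : τ → ℕ → ℕ) (H : Fin 4 → τ → ℕ → ℕ)
    (r : Fin 5 → τ) (x y c : ℕ) (hxy : (layered m X H).lev x = (layered m X H).lev y)
    (hx : (layered m X H).allow r x c) (hy : (layered m X H).allow r y c) : x = y := by
  change level m x = level m y at hxy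
  by_cases h : level m x < 4
  · rw [← hx ⟨level m x, h⟩ rfl, ← hy ⟨level m x, h⟩ hxy.symm]
  · have h1 : x < 1 := by
      by_contra h1
      apply h
      rw [level, if_neg h1]; split_ifs <;> omega
    have h2 : y < 1 := by
      by_contra h2
      apply h
      rw [hxy, level, if_neg h2]; split_ifs <;> omega
    omega

theorem abs_le_of_not_deviates {κ : ℝ} {w : ℕ} {h : ℕ → ℕ} {S T : Finset ℕ}
    (hd : ¬ Deviates κ w h S T) {σ l : ℝ} (hμ : (#S * #T / w : ℝ) ≤ σ) (hκ : κ ^ 2 ≤ σ)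
    (hl : κ ^ 2 * σ ≤ l ^ 2) (hl0 : 0 ≤ l) :
    |(#{i ∈ S | h i ∈ T} - #S * #T / w : ℝ)| ≤ l := by
  refine abs_le_of_sq_le_sq ?_ hl0
  exact (not_lt.1 hd).trans
    ((mul_le_mul_of_nonneg_left (max_le hμ hκ) (sq_nonneg κ)).trans hl)

/-- The coloring before level `t` uses the color hashes of earlier levels only; this is the source
of independence in `badColors_update`. -/
theorem colAfter_congr {ids : Finset ℕ} {nbr pal : ℕ → Finset ℕ} {lab lev : ℕ → ℕ}
    {allow allow' : ℕ → ℕ → Prop} {s t : ℕ}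
    (h : ∀ x c, lev x < t → (allow x c ↔ allow' x c)) :
    colAfter ids nbr pal lab lev allow s t = colAfter ids nbr pal lab lev allow' s t := by
  induction t with
  | zero => rfl
  | succ t ih =>
    have ih := ih fun x c hx => h x c (by omega)
    funext i
    rw [colAfter, colAfter, stageCol, stageCol, ih]
    by_cases hi : i ∈ ids ∧ lev (lab i) = t
    · rw [if_pos hi, if_pos hi]
      refine congrArg some (congrFun (listColor_congr (fun _ _ => rfl) fun j hj => ?_) i)
      congr 1
      ext c
      rw [mem_partPal, mem_partPal, h _ _ (by rw [(mem_members.1 hj).2]; omega)]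
    · rw [if_neg hi, if_neg hi]

/-- The neighbors of lower levels are the only ones that use up colors. -/
theorem card_le_card_avail (ids : Finset ℕ) (nbr pal : ℕ → Finset ℕ) (lab lev : ℕ → ℕ)
    (allow : ℕ → ℕ → Prop) (s t i : ℕ) :
    #(pal i) + #{j ∈ nbr i | t ≤ lev (lab j)} ≤
      #(avail (colAfter ids nbr pal lab lev allow s t) (nbr i) (pal i)) + #(nbr i) := by
  classical
  set col := colAfter ids nbr pal lab lev allow s t
  have h1 : pal i ⊆ avail col (nbr i) (pal i) ∪
      {j ∈ nbr i | ¬ t ≤ lev (lab j)}.image fun j => (col j).getD 0 := by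
    intro c hc
    by_cases hca : c ∈ avail col (nbr i) (pal i)
    · exact mem_union_left _ hca
    · rw [mem_avail] at hca
      push Not at hca
      obtain ⟨j, hj, hjc⟩ := hca hc
      refine mem_union_right _ (mem_image.2 ⟨j, mem_filter.2 ⟨hj, fun h => ?_⟩, by simp [hjc]⟩)
      rw [show col j = none from colAfter_of_le h] at hjc
      cases hjc
  have h2 := (card_le_card h1).trans (card_union_le _ _)
  have h3 := card_image_le (s := {j ∈ nbr i | ¬ t ≤ lev (lab j)}) (f := fun j => (col j).getD 0)
  have h4 := card_filter_add_card_filter_not (s := nbr i) fun j => t ≤ lev (lab j)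
  omega

/-- The number of available colors that is guaranteed at level `t`. -/
noncomputable def sampleSize (m Δ t : ℕ) : ℕ := ⌈((Δ : ℝ) - (m : ℝ) ^ 7 / 16) / (m : ℝ) ^ t⌉₊

/-- The sets of labels whose frequencies matter. -/
def testSets (m : ℕ) : Finset (Finset ℕ) :=
  (range (m ^ 4)).image singleton ∪ (range 5).image fun t => range (m ^ (4 - t))

variable {τ : Type} (m Δ : ℕ) (X : τ → ℕ → ℕ) (H : Fin 4 → τ → ℕ → ℕ) (ids : Finset ℕ)
  (nbr pal : ℕ → Finset ℕ)

/-- Some relevant frequency of labels is far from its expectation. -/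
def BadLabels (y : τ) : Prop :=
  ∃ S ∈ insert ids (ids.image nbr), ∃ T ∈ testSets m, Deviates (m / 32) (m ^ 4) (X y) S T

/-- The partial coloring before level `t`. -/
noncomputable def layeredCol (r : Fin 5 → τ) (t : ℕ) : ℕ → Option ℕ :=
  colAfter ids nbr pal ((layered m X H).lab r) (layered m X H).lev ((layered m X H).allow r)
    (3 * m ^ 4) t

/-- Some vertex of level `t` has a frequency of allowed colors that is far from its expectation. -/
def BadColors (t : Fin 4) (y : τ) (r : Fin 5 → τ) : Prop :=
  ∃ i ∈ ids, level m (X (r (Fin.last 4)) i) = t ∧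
    Deviates (m / 32) (m ^ (4 - (t : ℕ)) - m ^ (3 - (t : ℕ))) (H t y)
      (trunc (sampleSize m Δ t) (avail (layeredCol m X H ids nbr pal r t) (nbr i) (pal i)))
      {X (r (Fin.last 4)) i - m ^ (3 - (t : ℕ))}

theorem badColors_update (t : Fin 4) (x : τ) (r : Fin 5 → τ) (y : τ) :
    BadColors m Δ X H ids nbr pal t x (Function.update r t.castSucc y) ↔
      BadColors m Δ X H ids nbr pal t x r := by
  have h1 : Function.update r t.castSucc y (Fin.last 4) = r (Fin.last 4) :=
    Function.update_of_ne (Fin.castSucc_lt_last t).ne' _ _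
  have h2 : layeredCol m X H ids nbr pal (Function.update r t.castSucc y) t =
      layeredCol m X H ids nbr pal r t := by
    have hlab : (layered m X H).lab (Function.update r t.castSucc y) = (layered m X H).lab r := by
      simp only [layered, h1]
    rw [layeredCol, layeredCol, hlab]
    refine colAfter_congr fun x c hx => forall₂_congr fun u hu => ?_
    have hut : u ≠ t := by
      rintro rfl
      exact hx.ne hu
    rw [Function.update_of_ne fun h => hut (Fin.castSucc_injective _ h)]
  rw [BadColors, BadColors, h1, h2]

end Layered

/-! ### Undisturbed frequencies make a seed good. -/

section Good

open Finset

variable {τ : Type} {m Δ : ℕ} {X : τ → ℕ → ℕ} {H : Fin 4 → τ → ℕ → ℕ} {ids : Finset ℕ}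
  {nbr pal : ℕ → Finset ℕ}

/-- The mean is at most `2 * m ^ 4`, so the deviation is at most `m / 32 * √(2 * m ^ 4) ≤ m ^ 3 /
16`. -/
theorem card_label_le (hm : 16 ≤ m) (hΔ : Δ < 2 * m ^ 8) {y : τ}
    (hy : ¬ BadLabels m X ids nbr y) {i x : ℕ} (hi : i ∈ ids) (hx : x < m ^ 4)
    (hdeg : #(nbr i) ≤ Δ) :
    (#{j ∈ nbr i | X y j = x} : ℝ) ≤ Δ / (m : ℝ) ^ 4 + (m : ℝ) ^ 3 / 16 := by
  have hm' : (16 : ℝ) ≤ m := by exact_mod_cast hm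
  have hm0 : (0 : ℝ) < m := by linarith
  have hΔ' : (Δ : ℝ) ≤ 2 * (m : ℝ) ^ 8 := by exact_mod_cast hΔ.le
  have hdeg' : (#(nbr i) : ℝ) ≤ Δ := by exact_mod_cast hdeg
  have hd : ¬ Deviates (m / 32) (m ^ 4) (X y) (nbr i) {x} := fun h =>
    hy ⟨_, mem_insert_of_mem (mem_image_of_mem _ hi), _,
      mem_union_left _ (mem_image_of_mem _ (mem_range.2 hx)), h⟩
  have hμ : (#(nbr i) * #({x} : Finset ℕ) / (m ^ 4 : ℕ) : ℝ) ≤ Δ / (m : ℝ) ^ 4 := by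
    rw [card_singleton, Nat.cast_one, mul_one, Nat.cast_pow]
    gcongr
  have hμ' : (Δ / (m : ℝ) ^ 4 : ℝ) ≤ 2 * (m : ℝ) ^ 4 := by
    rw [div_le_iff₀ (by positivity)]
    calc (Δ : ℝ) ≤ 2 * (m : ℝ) ^ 8 := hΔ'
      _ = _ := by ring
  have hm2 : (m : ℝ) ^ 2 ≤ (m : ℝ) ^ 4 := pow_le_pow_right₀ (by linarith) (by norm_num)
  have := abs_le_of_not_deviates hd (hμ.trans hμ') (l := (m : ℝ) ^ 3 / 16)
    (by rw [div_pow]; linarith [sq_nonneg (m : ℝ)]) (by apply le_of_sub_nonneg; ring_nf; positivity)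
    (by positivity)
  simp only [mem_singleton] at this
  linarith [(abs_le.1 this).2]

theorem card_level_ge (hm : 16 ≤ m) (hΔ : Δ < 2 * m ^ 8) {y : τ}
    (hy : ¬ BadLabels m X ids nbr y) {i t : ℕ} (hi : i ∈ ids) (ht : t < 4)
    (hdeg : #(nbr i) ≤ Δ) :
    (#(nbr i) : ℝ) / (m : ℝ) ^ t - (m : ℝ) ^ 7 / 16 / (m : ℝ) ^ t ≤
      #{j ∈ nbr i | X y j < m ^ (4 - t)} := by
  have hm' : (16 : ℝ) ≤ m := by exact_mod_cast hm
  have hm0 : (0 : ℝ) < m := by linarith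
  have hΔ' : (Δ : ℝ) ≤ 2 * (m : ℝ) ^ 8 := by exact_mod_cast hΔ.le
  have hdeg' : (#(nbr i) : ℝ) ≤ Δ := by exact_mod_cast hdeg
  have hd : ¬ Deviates (m / 32) (m ^ 4) (X y) (nbr i) (range (m ^ (4 - t))) := fun h =>
    hy ⟨_, mem_insert_of_mem (mem_image_of_mem _ hi), _,
      mem_union_right _ (mem_image_of_mem _ (mem_range.2 (by omega : t < 5))), h⟩
  set a : ℝ := (m : ℝ) ^ t with ha
  have ha0 : 0 < a := by positivity
  have hab : a * (m : ℝ) ^ (4 - t) = (m : ℝ) ^ 4 := by rw [ha, ← pow_add]; congr 1; omega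
  have ham : a ≤ (m : ℝ) ^ 3 := pow_le_pow_right₀ (by linarith) (by omega)
  have hμ : (#(nbr i) * #(range (m ^ (4 - t))) / (m ^ 4 : ℕ) : ℝ) = #(nbr i) / a := by
    rw [card_range, Nat.cast_pow, Nat.cast_pow, ← hab]
    field_simp
  have hμ' : (#(nbr i) / a : ℝ) ≤ 2 * (m : ℝ) ^ 8 / a := by gcongr; linarith
  have h1 : ((m : ℝ) / 32) ^ 2 ≤ 2 * (m : ℝ) ^ 8 / a := by
    rw [le_div_iff₀ ha0]
    calc ((m : ℝ) / 32) ^ 2 * a ≤ ((m : ℝ) / 32) ^ 2 * (m : ℝ) ^ 3 := by gcongr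
      _ ≤ 1 * (m : ℝ) ^ 5 := by apply le_of_sub_nonneg; ring_nf; positivity
      _ ≤ 2 * (m : ℝ) ^ 8 := by
        have : (m : ℝ) ^ 5 ≤ (m : ℝ) ^ 8 := pow_le_pow_right₀ (by linarith) (by norm_num)
        have : (0 : ℝ) ≤ (m : ℝ) ^ 8 := by positivity
        linarith
  have h2 : ((m : ℝ) / 32) ^ 2 * (2 * (m : ℝ) ^ 8 / a) ≤ ((m : ℝ) ^ 7 / 16 / a) ^ 2 := by
    rw [div_pow _ a, ← mul_div_assoc, div_le_div_iff₀ ha0 (by positivity)]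
    have h3 : (m : ℝ) ^ 3 ≤ (m : ℝ) ^ 4 := pow_le_pow_right₀ (by linarith) (by norm_num)
    calc ((m : ℝ) / 32) ^ 2 * (2 * (m : ℝ) ^ 8) * a ^ 2
        = (m : ℝ) ^ 10 / 512 * a * a := by ring
      _ ≤ (m : ℝ) ^ 10 / 512 * (2 * (m : ℝ) ^ 4) * a := by
        gcongr
        have : (0 : ℝ) ≤ (m : ℝ) ^ 4 := by positivity
        linarith
      _ = ((m : ℝ) ^ 7 / 16) ^ 2 * a := by ring
  have := abs_le_of_not_deviates hd (hμ.trans_le hμ') h1 h2 (by positivity)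
  rw [hμ] at this
  simp only [mem_range] at this
  linarith [(abs_le.1 this).1]

/-- The mean is at least `m ^ 4`, hence the deviation is at most the mean, and a part has at most `2
* #ids / m ^ 4` vertices. -/
theorem card_members_le (hm : 16 ≤ m) (hΔ : m ^ 8 ≤ #ids) {y : τ}
    (hX : ∀ i, X y i < m ^ 4) (hy : ¬ BadLabels m X ids nbr y) (x : ℕ) :
    #(members ids (X y) x) * (3 * m ^ 4) ≤ 6 * #ids := by
  rcases le_or_gt (m ^ 4) x with hx | hx
  · have : members ids (X y) x = ∅ := by
      rw [members, filter_eq_empty_iff]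
      exact fun i _ h => absurd (hX i) (by omega)
    simp [this]
  have hm' : (16 : ℝ) ≤ m := by exact_mod_cast hm
  have hm0 : (0 : ℝ) < m := by linarith
  have hΔ' : (m : ℝ) ^ 8 ≤ #ids := by exact_mod_cast hΔ
  have hd : ¬ Deviates (m / 32) (m ^ 4) (X y) ids {x} := fun h =>
    hy ⟨_, mem_insert_self _ _, _,
      mem_union_left _ (mem_image_of_mem _ (mem_range.2 hx)), h⟩
  have hμ : (#ids * #({x} : Finset ℕ) / (m ^ 4 : ℕ) : ℝ) = #ids / (m : ℝ) ^ 4 := by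
    rw [card_singleton, Nat.cast_one, mul_one, Nat.cast_pow]
  set μ : ℝ := #ids / (m : ℝ) ^ 4 with hμd
  have h1 : (m : ℝ) ^ 4 ≤ μ := by
    rw [hμd, le_div_iff₀ (by positivity)]
    calc (m : ℝ) ^ 4 * (m : ℝ) ^ 4 = (m : ℝ) ^ 8 := by ring
      _ ≤ _ := hΔ'
  have hm2 : (m : ℝ) ^ 2 ≤ (m : ℝ) ^ 4 := pow_le_pow_right₀ (by linarith) (by norm_num)
  have h2 : ((m : ℝ) / 32) ^ 2 ≤ μ := by
    rw [div_pow]; linarith [sq_nonneg (m : ℝ)]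
  have h0 : 0 ≤ μ := by positivity
  have := abs_le_of_not_deviates hd hμ.le h2 (l := μ) (by nlinarith) h0
  rw [hμ] at this
  simp only [mem_singleton] at this
  have h3 : (#(members ids (X y) x) : ℝ) ≤ 2 * μ := by
    rw [members]; linarith [(abs_le.1 this).2]
  have h4 : (#(members ids (X y) x) * (3 * (m : ℝ) ^ 4) : ℝ) ≤ 6 * #ids := by
    calc (#(members ids (X y) x) * (3 * (m : ℝ) ^ 4) : ℝ)
        ≤ 2 * μ * (3 * (m : ℝ) ^ 4) := by gcongr
      _ = 6 * #ids := by rw [hμd]; field_simp; ring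
  exact_mod_cast h4

/-- Only `sampleSize m Δ t` of the available colors are counted: that bounds the mean by `4 * m ^ 4`
and the deviation by `m ^ 3 / 16`, and further colors can only help. The right-hand bound of
`card_label_le` is what has to be beaten. -/
theorem card_colors_gt (hm : 16 ≤ m) (hΔ : m ^ 8 ≤ Δ) (hΔ' : Δ < 2 * m ^ 8) {t : ℕ} (ht : t < 4)
    {h : ℕ → ℕ} {A : Finset ℕ} (hA : sampleSize m Δ t ≤ #A) {z : ℕ}
    (hd : ¬ Deviates (m / 32) (m ^ (4 - t) - m ^ (3 - t)) h (trunc (sampleSize m Δ t) A) {z}) :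
    Δ / (m : ℝ) ^ 4 + (m : ℝ) ^ 3 / 16 < #{c ∈ A | h c = z} := by
  have hm' : (16 : ℝ) ≤ m := by exact_mod_cast hm
  have hm0 : (0 : ℝ) < m := by linarith
  have hΔr : (m : ℝ) ^ 8 ≤ Δ := by exact_mod_cast hΔ
  have hΔr' : (Δ : ℝ) ≤ 2 * (m : ℝ) ^ 8 := by exact_mod_cast hΔ'.le
  have hp : #(trunc (sampleSize m Δ t) A) = sampleSize m Δ t := by
    rw [card_trunc, min_eq_left hA]
  have hsub : (#{c ∈ trunc (sampleSize m Δ t) A | h c ∈ ({z} : Finset ℕ)} : ℝ) ≤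
      #{c ∈ A | h c = z} := by
    simp only [mem_singleton]
    exact_mod_cast card_le_card (filter_subset_filter _ (trunc_subset _ _))
  set a : ℝ := (m : ℝ) ^ t with ha
  set c : ℝ := (m : ℝ) ^ (3 - t) with hc
  have ha0 : 0 < a := by positivity
  have hc0 : 0 < c := by positivity
  have hac : a * c = (m : ℝ) ^ 3 := by rw [ha, hc, ← pow_add]; congr 1; omega
  have ham : a ≤ (m : ℝ) ^ 3 := pow_le_pow_right₀ (by linarith) (by omega)
  have hk : ((m ^ (4 - t) - m ^ (3 - t) : ℕ) : ℝ) = c * (m - 1) := by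
    rw [Nat.cast_sub (Nat.pow_le_pow_right (by omega) (by omega)), Nat.cast_pow, Nat.cast_pow,
      show 4 - t = 3 - t + 1 by omega, pow_succ]
    ring
  have hk0 : 0 < c * ((m : ℝ) - 1) := mul_pos hc0 (by linarith)
  set p : ℝ := (sampleSize m Δ t : ℝ) with hpd
  set q : ℝ := (m : ℝ) ^ 7 / 16 with hq
  have hq7 : (m : ℝ) ^ 3 ≤ q := by
    rw [hq, le_div_iff₀ (by norm_num)]
    calc (m : ℝ) ^ 3 * 16 ≤ (m : ℝ) ^ 3 * m := by gcongr
      _ = (m : ℝ) ^ 4 := by ring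
      _ ≤ (m : ℝ) ^ 7 := pow_le_pow_right₀ (by linarith) (by norm_num)
  have hqΔ : q ≤ Δ := by
    refine le_trans ?_ hΔr
    have : (m : ℝ) ^ 7 ≤ (m : ℝ) ^ 8 := pow_le_pow_right₀ (by linarith) (by norm_num)
    have : (0 : ℝ) ≤ (m : ℝ) ^ 7 := by positivity
    rw [hq]; linarith
  have hp1 : (Δ - q) / a ≤ p := Nat.le_ceil _
  -- Rounding up adds less than `1`, that is `a ≤ m ^ 3 ≤ q` in the numerator, which the subtracted
  -- `q` absorbs.
  have hp2 : p ≤ 2 * (m : ℝ) ^ 8 / a := by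
    have h1 : p < (Δ - q) / a + 1 := Nat.ceil_lt_add_one (div_nonneg (by linarith) ha0.le)
    have h2 : (Δ - q) / a + 1 = (Δ - q + a) / a := by field_simp
    rw [h2] at h1
    refine h1.le.trans ?_
    gcongr
    linarith
  have hμ : (#(trunc (sampleSize m Δ t) A) * #({z} : Finset ℕ) /
      (m ^ (4 - t) - m ^ (3 - t) : ℕ) : ℝ) = p / (c * (m - 1)) := by
    rw [hp, card_singleton, hk, Nat.cast_one, mul_one]
  have hμ2 : p / (c * (m - 1)) ≤ 4 * (m : ℝ) ^ 4 := by
    rw [div_le_iff₀ hk0]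
    refine hp2.trans ?_
    rw [div_le_iff₀ ha0]
    calc 2 * (m : ℝ) ^ 8 = 4 * (m : ℝ) ^ 4 * ((m : ℝ) ^ 3 * (m / 2)) := by ring
      _ ≤ 4 * (m : ℝ) ^ 4 * ((m : ℝ) ^ 3 * (m - 1)) := by gcongr; linarith
      _ = _ := by rw [← hac]; ring
  have hm2 : (m : ℝ) ^ 2 ≤ (m : ℝ) ^ 4 := pow_le_pow_right₀ (by linarith) (by norm_num)
  have hdev := abs_le_of_not_deviates hd (hμ.trans_le hμ2) (l := (m : ℝ) ^ 3 / 16)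
    (by rw [div_pow]; linarith [sq_nonneg (m : ℝ)]) (by apply le_of_eq; ring)
    (by positivity)
  rw [hμ] at hdev
  refine lt_of_lt_of_le ?_ hsub
  -- After clearing denominators this is `(Δ + m ^ 7 / 8) * (m - 1) < (Δ - m ^ 7 / 16) * m`, where
  -- the gain `Δ ≥ m ^ 8` beats `3 / 16 * m ^ 8`. Of the surplus `m ^ 3 / 8`, half pays for the
  -- deviation of the colors and half for that of the neighbors.
  have hlow : Δ / (m : ℝ) ^ 4 + (m : ℝ) ^ 3 / 8 < p / (c * (m - 1)) := by
    rw [lt_div_iff₀ hk0]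
    refine lt_of_lt_of_le ?_ hp1
    rw [lt_div_iff₀ ha0]
    have h1 : (Δ / (m : ℝ) ^ 4 + (m : ℝ) ^ 3 / 8) * (c * (m - 1)) * a =
        (Δ + (m : ℝ) ^ 7 / 8) * (m - 1) / m := by
      calc (Δ / (m : ℝ) ^ 4 + (m : ℝ) ^ 3 / 8) * (c * (m - 1)) * a
          = (Δ / (m : ℝ) ^ 4 + (m : ℝ) ^ 3 / 8) * (a * c) * (m - 1) := by ring
        _ = _ := by rw [hac]; field_simp
    rw [h1, div_lt_iff₀ hm0, hq]
    have h2 : (m : ℝ) ^ 8 = (m : ℝ) ^ 7 * m := by ring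
    have h3 : (0 : ℝ) < (m : ℝ) ^ 7 := by positivity
    have h4 : (0 : ℝ) < (m : ℝ) ^ 7 * m := by positivity
    rw [h2] at hΔr
    nlinarith
  linarith [(abs_le.1 hdev).1]

theorem layered_good (hm : 16 ≤ m) (hΔ : m ^ 8 ≤ Δ) (hΔ' : Δ < 2 * m ^ 8) (hn : Δ < #ids)
    (hX : ∀ y i, X y i < m ^ 4) (hdeg : ∀ i ∈ ids, #(nbr i) ≤ Δ)
    (hpal : ∀ i ∈ ids, #(pal i) = Δ + 1) {r : Fin 5 → τ}
    (hlab : ¬ BadLabels m X ids nbr (r (Fin.last 4)))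
    (hcol : ∀ t : Fin 4, ¬ BadColors m Δ X H ids nbr pal t (r t.castSucc) r) :
    (layered m X H).Good r 5 6 (3 * m ^ 4) ids nbr pal := by
  have hm' : (16 : ℝ) ≤ m := by exact_mod_cast hm
  have hm0 : (0 : ℝ) < m := by linarith
  have hm1 : 1 ≤ m := by omega
  set y := r (Fin.last 4) with hy
  have hpart : ∀ i ∈ ids, (#(partNbr (X y) (nbr i) i) : ℝ) ≤
      Δ / (m : ℝ) ^ 4 + (m : ℝ) ^ 3 / 16 := fun i hi =>
    card_label_le hm hΔ' hlab hi (hX y i) (hdeg i hi)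
  refine ⟨fun i _ => ?_, fun i _ => ?_, fun x => ?_, fun i hi => ?_, fun i hi => ?_⟩
  · exact (hX y i).trans_le (((Nat.pow_le_pow_right hm1 (by norm_num)).trans hΔ).trans hn.le)
  · exact Nat.lt_succ_of_le (level_le _ _)
  · exact card_members_le hm (hΔ.trans hn.le) (hX y) hlab x
  · have h1 := hpart i hi
    have h2 : Δ / (m : ℝ) ^ 4 ≤ 2 * (m : ℝ) ^ 4 := by
      rw [div_le_iff₀ (by positivity)]
      calc (Δ : ℝ) ≤ 2 * (m : ℝ) ^ 8 := by exact_mod_cast hΔ'.le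
        _ = _ := by ring
    have h3 : (m : ℝ) ^ 3 ≤ (m : ℝ) ^ 4 := pow_le_pow_right₀ (by linarith) (by norm_num)
    have h4 : (0 : ℝ) < (m : ℝ) ^ 4 := by positivity
    have : (#(partNbr (X y) (nbr i) i) : ℝ) < 3 * (m : ℝ) ^ 4 := by linarith
    exact_mod_cast this
  · change #(partNbr (X y) (nbr i) i) < #(partPal (X y) ((layered m X H).allow r)
      (layeredCol m X H ids nbr pal r (level m (X y i))) (nbr i) (pal i) i)
    set t := level m (X y i) with ht
    have hav := card_le_card_avail ids nbr pal (X y) (level m) ((layered m X H).allow r)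
      (3 * m ^ 4) t i
    change _ ≤ #(avail (layeredCol m X H ids nbr pal r t) (nbr i) (pal i)) + _ at hav
    rw [hpal i hi] at hav
    set A := avail (layeredCol m X H ids nbr pal r t) (nbr i) (pal i) with hA
    rcases (level_le m (X y i)).lt_or_eq with ht4 | ht4
    · rw [← ht] at ht4
      have hlev : {j ∈ nbr i | t ≤ level m (X y j)} = {j ∈ nbr i | X y j < m ^ (4 - t)} :=
        filter_congr fun j _ => le_level_iff hm1 ht4.le (hX y j)
      rw [hlev] at hav
      have hge := card_level_ge hm hΔ' hlab hi ht4 (hdeg i hi)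
      have hsize : sampleSize m Δ t ≤ #A := by
        refine Nat.ceil_le.2 ?_
        have h1 : ((Δ + 1 + #{j ∈ nbr i | X y j < m ^ (4 - t)} : ℕ) : ℝ) ≤
          ((#A + #(nbr i) : ℕ) : ℝ) := by exact_mod_cast hav
        push_cast at h1
        have h2 : (#(nbr i) : ℝ) ≤ Δ := by exact_mod_cast hdeg i hi
        have h3 : (1 : ℝ) ≤ (m : ℝ) ^ t := one_le_pow₀ (by linarith)
        -- A vertex of degree below `Δ` has that many spare colors from the outset, so the bound is
        -- the same as for full degree.
        have h4 : (Δ - #(nbr i) : ℝ) / (m : ℝ) ^ t ≤ Δ - #(nbr i) :=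
          div_le_self (by linarith) h3
        rw [sub_div] at h4 ⊢
        linarith
      have hd := fun h => hcol ⟨t, ht4⟩ ⟨i, hi, rfl, h⟩
      have hgt := card_colors_gt hm hΔ hΔ' ht4 hsize hd
      have hle : m ^ (3 - t) ≤ X y i := by
        by_contra hlt
        have := (le_level_iff (t := t + 1) hm1 (by omega) (hX y i)).2
          (by rw [show 4 - (t + 1) = 3 - t by omega]; omega)
        omega
      have hsub : {c ∈ A | H ⟨t, ht4⟩ (r (Fin.castSucc ⟨t, ht4⟩)) c = X y i - m ^ (3 - t)} ⊆
          partPal (X y) ((layered m X H).allow r)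
            (layeredCol m X H ids nbr pal r t) (nbr i) (pal i) i := by
        intro c hc
        obtain ⟨hcA, hc⟩ := mem_filter.1 hc
        refine mem_partPal.2 ⟨hcA, fun u hu => ?_⟩
        obtain rfl : u = ⟨t, ht4⟩ := Fin.ext hu.symm
        rw [hc]
        exact Nat.sub_add_cancel hle
      have := (hpart i hi).trans_lt (hgt.trans_le (Nat.cast_le.2 (card_le_card hsub)))
      exact_mod_cast this
    · have hx : X y i < 1 := by
        have := (le_level_iff hm1 le_rfl (hX y i)).1 ht4.ge
        simpa using this
      -- In the last part the uncolored neighbors are exactly those in the same part; all others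
      -- cost at most one color each.
      have hlev : {j ∈ nbr i | t ≤ level m (X y j)} = partNbr (X y) (nbr i) i := by
        refine filter_congr fun j _ => ?_
        rw [ht, ht4, le_level_iff hm1 le_rfl (hX y j)]
        simp only [Nat.sub_self, pow_zero]
        omega
      rw [hlev] at hav
      have hall : partPal (X y) ((layered m X H).allow r)
          (layeredCol m X H ids nbr pal r t) (nbr i) (pal i) i = A := by
        ext c
        rw [mem_partPal]
        refine and_iff_left fun u hu => ?_
        have := u.is_lt
        omega
      rw [hall]
      have := hdeg i hi
      omega

end Good

/-! ### Counting bad seeds. -/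

section Failure

open Finset

theorem card_filter_exists_le {α β : Type*} [Fintype α] (J : Finset β) (Q : β → α → Prop)
    {_ : DecidablePred fun x => ∃ j ∈ J, Q j x} {hQ : ∀ j, DecidablePred (Q j)} {q : ℝ}
    (h : ∀ j ∈ J, (#{x | Q j x} : ℝ) ≤ q) : (#{x | ∃ j ∈ J, Q j x} : ℝ) ≤ #J * q := by
  classical
  have h1 : ({x | ∃ j ∈ J, Q j x} : Finset α) = J.biUnion fun j => {x | Q j x} := by
    ext x; simp
  rw [h1, ← nsmul_eq_mul]
  calc (#(J.biUnion fun j => ({x | Q j x} : Finset α)) : ℝ)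
      ≤ ∑ j ∈ J, (#{x | Q j x} : ℝ) := by exact_mod_cast card_biUnion_le
    _ ≤ #J • q := sum_le_card_nsmul _ _ _ h

theorem card_testSets_le (m : ℕ) : #(testSets m) ≤ m ^ 4 + 5 := by
  refine (card_union_le _ _).trans (add_le_add ?_ ?_)
  · exact card_image_le.trans_eq (card_range _)
  · exact card_image_le.trans_eq (card_range _)

theorem subset_range_of_mem_testSets {m : ℕ} (hm : 1 ≤ m) {T : Finset ℕ} (hT : T ∈ testSets m) :
    T ⊆ range (m ^ 4) := by
  rcases mem_union.1 hT with h | h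
  · obtain ⟨x, hx, rfl⟩ := mem_image.1 h
    simpa using hx
  · obtain ⟨t, -, rfl⟩ := mem_image.1 h
    exact range_subset_range.2 (Nat.pow_le_pow_right hm (by omega))

variable {τ : Type} [Fintype τ] {m Δ D : ℕ} {X : τ → ℕ → ℕ} {H : Fin 4 → τ → ℕ → ℕ}
  {ids : Finset ℕ} {nbr pal : ℕ → Finset ℕ}

open Classical in
theorem card_badLabels_le (hm : 1 ≤ m) (hids : ids ⊆ range D) (hnbr : ∀ i ∈ ids, nbr i ⊆ range D)
    {q : ℝ} (hq : 0 ≤ q)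
    (hXd : ∀ S ⊆ range D, ∀ T ⊆ range (m ^ 4),
      (#{y | Deviates (m / 32) (m ^ 4) (X y) S T} : ℝ) ≤ q * Fintype.card τ) :
    (#{r : Fin 5 → τ | BadLabels m X ids nbr (r (Fin.last 4))} : ℝ) ≤
      (#ids + 1) * (m ^ 4 + 5) * q * Fintype.card (Fin 5 → τ) := by
  refine card_filter_apply_le (Fin.last 4) (fun y _ => BadLabels m X ids nbr y)
    (fun _ _ _ => Iff.rfl) fun _ => ?_
  have h0 : ∀ S ∈ insert ids (ids.image nbr),
      (#{y | ∃ T ∈ testSets m, Deviates (m / 32) (m ^ 4) (X y) S T} : ℝ) ≤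
        (m ^ 4 + 5) * (q * Fintype.card τ) := by
    intro S hS
    have hSD : S ⊆ range D := by
      rcases mem_insert.1 hS with rfl | hS
      · exact hids
      · obtain ⟨i, hi, rfl⟩ := mem_image.1 hS
        exact hnbr i hi
    have hT : (#{y | ∃ T ∈ testSets m, Deviates (m / 32) (m ^ 4) (X y) S T} : ℝ) ≤
        #(testSets m) * (q * Fintype.card τ) := card_filter_exists_le (testSets m)
      (fun T y => Deviates (m / 32) (m ^ 4) (X y) S T) fun T hT =>
        hXd S hSD T (subset_range_of_mem_testSets hm hT)
    refine hT.trans ?_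
    gcongr
    exact_mod_cast card_testSets_le m
  have h1 : (#{y | BadLabels m X ids nbr y} : ℝ) ≤
      #(insert ids (ids.image nbr)) * ((m ^ 4 + 5) * (q * Fintype.card τ)) :=
    card_filter_exists_le _
      (fun S y => ∃ T ∈ testSets m, Deviates (m / 32) (m ^ 4) (X y) S T) h0
  have h2 : (#(insert ids (ids.image nbr)) : ℝ) ≤ #ids + 1 := by
    exact_mod_cast (card_insert_le _ _).trans (Nat.add_le_add_right card_image_le 1)
  refine h1.trans ?_
  calc (#(insert ids (ids.image nbr)) : ℝ) * ((m ^ 4 + 5) * (q * Fintype.card τ))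
      ≤ (#ids + 1) * ((m ^ 4 + 5) * (q * Fintype.card τ)) := by gcongr
    _ = _ := by ring

open Classical in
-- Once the other coordinates of the seed are fixed, the available colors are a fixed set for each
-- vertex, so the guarantee of the hash family applies vertex by vertex.
theorem card_badColors_le (hm : 1 ≤ m) (hX : ∀ y i, X y i < m ^ 4)
    (hpal : ∀ i ∈ ids, pal i ⊆ range D) {q : ℝ} (hq : 0 ≤ q) (t : Fin 4)
    (hHd : ∀ S ⊆ range D, ∀ T ⊆ range (m ^ (4 - (t : ℕ)) - m ^ (3 - (t : ℕ))),
      (#{y | Deviates (m / 32) (m ^ (4 - (t : ℕ)) - m ^ (3 - (t : ℕ))) (H t y) S T} : ℝ) ≤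
        q * Fintype.card τ) :
    (#{r : Fin 5 → τ | BadColors m Δ X H ids nbr pal t (r t.castSucc) r} : ℝ) ≤
      #ids * q * Fintype.card (Fin 5 → τ) := by
  refine card_filter_apply_le t.castSucc (fun y r => BadColors m Δ X H ids nbr pal t y r)
    (fun x r y => badColors_update m Δ X H ids nbr pal t x r y) fun r => ?_
  rw [mul_assoc]
  refine card_filter_exists_le ids (hQ := fun _ _ => instDecidableAnd) (fun i y => level m (X (r (Fin.last 4)) i) = t ∧
    Deviates (m / 32) (m ^ (4 - (t : ℕ)) - m ^ (3 - (t : ℕ))) (H t y)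
      (trunc (sampleSize m Δ t) (avail (layeredCol m X H ids nbr pal r t) (nbr i) (pal i)))
      {X (r (Fin.last 4)) i - m ^ (3 - (t : ℕ))}) fun i hi => ?_
  by_cases hlev : level m (X (r (Fin.last 4)) i) = t
  · have h1 := (le_level_iff hm t.is_lt.le (hX (r (Fin.last 4)) i)).1 hlev.ge
    have h2 : ¬ X (r (Fin.last 4)) i < m ^ (4 - ((t : ℕ) + 1)) := fun h => by
      have := (le_level_iff hm t.is_lt (hX (r (Fin.last 4)) i)).2 h
      omega
    rw [show 4 - ((t : ℕ) + 1) = 3 - t by omega] at h2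
    refine le_trans (Nat.cast_le.2 (card_le_card fun y hy => ?_))
      (hHd (trunc (sampleSize m Δ t) (avail (layeredCol m X H ids nbr pal r t) (nbr i) (pal i))) ((trunc_subset _ _).trans fun c hc => hpal i hi (mem_avail.1 hc).1) _
        (singleton_subset_iff.2 (mem_range.2 (?_ : X (r (Fin.last 4)) i - m ^ (3 - (t : ℕ)) < _))))
    · exact mem_filter.2 ⟨mem_univ y, (mem_filter.1 hy).2.2⟩
    · omega
  · rw [filter_false_of_mem fun y _ h => hlev h.1, card_empty, Nat.cast_zero]
    positivity

open Classical in
theorem card_bad_le (hm : 1 ≤ m) (hX : ∀ y i, X y i < m ^ 4) (hids : ids ⊆ range D)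
    (hnbr : ∀ i ∈ ids, nbr i ⊆ range D) (hpal : ∀ i ∈ ids, pal i ⊆ range D) {q : ℝ} (hq : 0 ≤ q)
    (hXd : ∀ S ⊆ range D, ∀ T ⊆ range (m ^ 4),
      (#{y | Deviates (m / 32) (m ^ 4) (X y) S T} : ℝ) ≤ q * Fintype.card τ)
    (hHd : ∀ t : Fin 4, ∀ S ⊆ range D, ∀ T ⊆ range (m ^ (4 - (t : ℕ)) - m ^ (3 - (t : ℕ))),
      (#{y | Deviates (m / 32) (m ^ (4 - (t : ℕ)) - m ^ (3 - (t : ℕ))) (H t y) S T} : ℝ) ≤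
        q * Fintype.card τ) :
    (#{r : Fin 5 → τ | BadLabels m X ids nbr (r (Fin.last 4)) ∨
      ∃ t : Fin 4, BadColors m Δ X H ids nbr pal t (r t.castSucc) r} : ℝ) ≤
      ((#ids + 1) * (m ^ 4 + 5) + 4 * #ids) * q * Fintype.card (Fin 5 → τ) := by
  have hlab := card_badLabels_le hm hids hnbr hq hXd
  have hex : (#(univ.biUnion fun t : Fin 4 => ({r | BadColors m Δ X H ids nbr pal t
      (r t.castSucc) r} : Finset (Fin 5 → τ))) : ℝ) ≤
        4 * (#ids * q * Fintype.card (Fin 5 → τ)) := by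
    refine (Nat.cast_le.2 card_biUnion_le).trans ?_
    rw [Nat.cast_sum]
    refine (sum_le_sum fun t _ => card_badColors_le hm hX hpal hq t (hHd t)).trans_eq ?_
    simp
  have hsub : ({r : Fin 5 → τ | BadLabels m X ids nbr (r (Fin.last 4)) ∨
      ∃ t : Fin 4, BadColors m Δ X H ids nbr pal t (r t.castSucc) r} : Finset (Fin 5 → τ)) ⊆
      ({r | BadLabels m X ids nbr (r (Fin.last 4))} : Finset (Fin 5 → τ)) ∪
        univ.biUnion fun t : Fin 4 =>
          ({r | BadColors m Δ X H ids nbr pal t (r t.castSucc) r} : Finset (Fin 5 → τ)) := by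
    intro r hr
    rcases (mem_filter.1 hr).2 with h | ⟨t, h⟩
    · exact mem_union_left _ (mem_filter.2 ⟨mem_univ r, h⟩)
    · exact mem_union_right _ (mem_biUnion.2 ⟨t, mem_univ t, mem_filter.2 ⟨mem_univ r, h⟩⟩)
  have h3 := (Nat.cast_le (α := ℝ)).2 ((card_le_card hsub).trans (card_union_le _ _))
  rw [Nat.cast_add] at h3
  refine h3.trans ((add_le_add hlab hex).trans_eq ?_)
  ring

end Failure

/-! ### From few bad seeds to high probability. -/

section Success

variable {n : ℕ}

open Classical in
/-- A scheme for which most seeds are good yields an algorithm. -/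
theorem exists_algorithm_of_scheme (hn : 0 < n) {Δ D T C s d b b₀ : ℕ}
    (S : Scheme (Fin 5 → Message b₀))
    (hdisj : ∀ r x y c, S.lev x = S.lev y → S.allow r x c → S.allow r y c → x = y)
    (hb₀ : 5 * b₀ ≤ b) (hb : ((D + 1) * (D + 1)) ^ C ≤ 2 ^ b) (hb' : D + 1 ≤ 2 ^ b)
    (hbad : ∀ (ids : Finset ℕ) (nbr pal : ℕ → Finset ℕ), ids.card = n → ids ⊆ Finset.range D →
      (∀ i ∈ ids, nbr i ⊆ Finset.range D) → (∀ i ∈ ids, (nbr i).card ≤ Δ) →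
      (∀ i ∈ ids, pal i ⊆ Finset.range D) → (∀ i ∈ ids, (pal i).card = Δ + 1) → Δ < n →
      (({r | ¬ S.Good r T C s ids nbr pal} : Finset (Fin 5 → Message b₀)).card : ℝ) * (n : ℝ) ^ d ≤
        Fintype.card (Fin 5 → Message b₀)) :
    ∃ A : Algorithm b, ∀ (G : SimpleGraph (Fin n)) [DecidableRel G.Adj], G.maxDegree = Δ →
      ∀ ident : Fin n → ℕ, Function.Injective ident → (∀ v, ident v < D) →
      ∀ Ψ : Fin n → Finset ℕ, (∀ v, (Ψ v).card = G.maxDegree + 1) →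
      (∀ v, ∀ x ∈ Ψ v, x < D) →
      coins n {ω | ¬ IsListColoring G Ψ (result A (1 + 4 * T) G ident Ψ ω)} ≤
        1 / (n : ℝ≥0∞) ^ d := by
  let e : Fin 5 × Fin b₀ → ℕ := fun z => finProdFinEquiv z
  have he : Function.Injective e := Fin.val_injective.comp finProdFinEquiv.injective
  let draw (ω : ℕ → Bool) : Fin 5 → Message b₀ := fun k j => ω (e (k, j))
  have : Inhabited (Fin 5 → Message b₀) := ⟨fun _ _ => false⟩
  obtain ⟨A, hA⟩ := S.exists_algorithm (n := n) hdisj draw (b := b) (T := T) (C := C) (D := D)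
    (s := s) (by
      simp only [Fintype.card_fun, Fintype.card_bool, Fintype.card_fin]
      rw [← pow_mul]
      exact Nat.pow_le_pow_right two_pos (by omega)) hb hb'
  refine ⟨A, fun G inst hΔ ident hid hidD Ψ hΨ hΨD => ?_⟩
  have hne : ((Finset.univ.image ident : Finset ℕ) : Set ℕ).Nonempty :=
    ⟨ident ⟨0, hn⟩, by simp⟩
  -- The processor that draws the seed is determined by the IDs alone, so its coins are unbiased.
  obtain ⟨v, -, hv⟩ := Finset.mem_image.1 (Finset.mem_coe.1 (Nat.sInf_mem hne))
  have hcard : (Finset.univ.image ident).card = n := by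
    rw [Finset.card_image_of_injective _ hid, Finset.card_univ, Fintype.card_fin]
  have hmem : ∀ i ∈ Finset.univ.image ident, ∃ u, ident u = i := fun i hi => by simpa using hi
  have hlt : Δ < n := by
    have : Nonempty (Fin n) := ⟨⟨0, hn⟩⟩
    obtain ⟨u, hu⟩ := G.exists_maximal_degree_vertex
    rw [← hΔ, hu]
    simpa using G.degree_lt_card_verts u
  have key := hbad (Finset.univ.image ident) (nbrOf G ident) (palOf Ψ ident) hcard
    (fun i hi => by obtain ⟨u, rfl⟩ := hmem i hi; exact Finset.mem_range.2 (hidD u))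
    (fun i hi j hj => by
      obtain ⟨u, w, -, -, rfl⟩ := (mem_nbrOf G hid).1 hj
      exact Finset.mem_range.2 (hidD w))
    (fun i hi => by
      obtain ⟨u, rfl⟩ := hmem i hi
      rw [nbrOf_ident G hid, Finset.card_image_of_injective _ hid, G.card_neighborFinset_eq_degree,
        ← hΔ]
      exact G.degree_le_maxDegree u)
    (fun i hi c hc => by
      obtain ⟨u, rfl⟩ := hmem i hi
      rw [palOf_ident Ψ hid] at hc
      exact Finset.mem_range.2 (hΨD u c hc))
    (fun i hi => by
      obtain ⟨u, rfl⟩ := hmem i hi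
      rw [palOf_ident Ψ hid, hΨ, hΔ]) hlt
  let B : Finset (Fin 5 × Fin b₀ → Bool) := {f | ¬ S.Good (Function.curry f) T C s
    (Finset.univ.image ident) (nbrOf G ident) (palOf Ψ ident)}
  have hB : B.card = ({r | ¬ S.Good r T C s (Finset.univ.image ident) (nbrOf G ident)
      (palOf Ψ ident)} : Finset (Fin 5 → Message b₀)).card :=
    Finset.card_equiv (Equiv.curry (Fin 5) (Fin b₀) Bool) fun f => by simp [B]
  have hcardσ : (Fintype.card (Fin 5 → Message b₀) : ℝ) = 2 ^ Fintype.card (Fin 5 × Fin b₀) := by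
    simp only [Fintype.card_fun, Fintype.card_bool, Fintype.card_fin, Fintype.card_prod]
    push_cast
    rw [← pow_mul, mul_comm]
  refine (measure_mono fun ω hω => ?_).trans (coins_le v he B (d := d) ?_)
  · simp only [Set.mem_ofPred_eq] at hω ⊢
    refine Finset.mem_filter.2 ⟨Finset.mem_univ _, fun hgood => hω ?_⟩
    exact hA G ident hid hidD Ψ hΨD ω v hv hgood
  · rw [hB, ← hcardσ]
    exact key

end Success

/-! ### Choice of the parameters. -/

theorem lt_two_pow_logBits (n : ℕ) : n < 2 ^ logBits n := Nat.lt_pow_succ_log_self one_lt_two n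

theorem two_pow_logBits_le {n : ℕ} (hn : 0 < n) : 2 ^ logBits n ≤ 2 * n := by
  rw [logBits, pow_succ, mul_comm]
  exact Nat.mul_le_mul_left 2 (Nat.pow_log_le_self 2 hn.ne')

theorem two_le_two_pow_logBits (n : ℕ) : 2 ≤ 2 ^ logBits n :=
  Nat.le_self_pow (by simp [logBits]) 2

theorem pow_add_one_le {L a : ℕ} (hL : 2 ≤ L) : L ^ a + 1 ≤ L ^ (a + 1) := by
  have : 1 ≤ L ^ a := Nat.one_le_pow _ _ (by omega)
  calc L ^ a + 1 ≤ L ^ a * 2 := by omega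
    _ ≤ L ^ a * L := Nat.mul_le_mul_left _ hL
    _ = L ^ (a + 1) := (pow_succ L a).symm

theorem words_le {a C B n : ℕ} (hB : 2 * (a + 1) * C ≤ B) :
    ((2 ^ (a * logBits n) + 1) * (2 ^ (a * logBits n) + 1)) ^ C ≤ 2 ^ (B * logBits n) := by
  have hL := two_le_two_pow_logBits n
  rw [mul_comm a, mul_comm B, pow_mul, pow_mul]
  set L := 2 ^ logBits n
  calc ((L ^ a + 1) * (L ^ a + 1)) ^ C ≤ (L ^ (a + 1) * L ^ (a + 1)) ^ C :=
        Nat.pow_le_pow_left (Nat.mul_le_mul (pow_add_one_le hL) (pow_add_one_le hL)) C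
    _ = L ^ (2 * (a + 1) * C) := by rw [← pow_add, ← pow_mul]; congr 1; ring
    _ ≤ L ^ B := Nat.pow_le_pow_right (by omega) hB

theorem word_le {a B n : ℕ} (hB : a + 1 ≤ B) :
    2 ^ (a * logBits n) + 1 ≤ 2 ^ (B * logBits n) := by
  have hL := two_le_two_pow_logBits n
  rw [mul_comm a, mul_comm B, pow_mul, pow_mul]
  exact (pow_add_one_le hL).trans (Nat.pow_le_pow_right (by omega) hB)

/-- The algorithm succeeds with high probability. -/
def Succeeds (n Δ D R d : ℕ) {b : ℕ} (A : Algorithm b) : Prop :=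
  ∀ (G : SimpleGraph (Fin n)) [DecidableRel G.Adj], G.maxDegree = Δ →
    ∀ ident : Fin n → ℕ, Function.Injective ident → (∀ v, ident v < D) →
    ∀ Ψ : Fin n → Finset ℕ, (∀ v, (Ψ v).card = G.maxDegree + 1) →
    (∀ v, ∀ x ∈ Ψ v, x < D) →
    coins n {ω | ¬ IsListColoring G Ψ (result A R G ident Ψ ω)} ≤ 1 / (n : ℝ≥0∞) ^ d

/-- A single part on level `0` with all colors allowed: its leader receives `n` words from each of
fewer than `N` vertices, within the capacity `N * n`. No seed is bad. -/
theorem exists_succeeds_of_lt {n N : ℕ} (hn : 0 < n) (hN : n < N) (Δ : ℕ) {a d B : ℕ}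
    (hB : 5 + (a + 1) + 2 * (a + 1) * N ≤ B) :
    ∃ A : Algorithm (B * logBits n), Succeeds n Δ (2 ^ (a * logBits n)) 21 d A := by
  classical
  refine exists_algorithm_of_scheme hn (T := 5) (C := N) (s := n) (d := d) (b₀ := logBits n)
    ⟨fun _ _ => 0, fun x => x, fun _ _ _ => True⟩ (fun _ _ _ _ h _ _ => h)
    (Nat.mul_le_mul_right _ (by omega)) (words_le (by omega)) (word_le (by omega)) ?_
  intro ids nbr pal hids _ _ hnbr _ hpal hΔ
  have hpart : ∀ i ∈ ids, (partNbr (fun _ => 0) (nbr i) i).card ≤ Δ := fun i hi =>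
    (Finset.card_le_card (Finset.filter_subset _ _)).trans (hnbr i hi)
  rw [Finset.filter_false_of_mem, Finset.card_empty, Nat.cast_zero, zero_mul]
  · positivity
  rintro r -
  rw [not_not]
  refine ⟨fun i _ => by rw [hids]; exact hn, fun i _ => by norm_num, fun x => ?_,
    fun i hi => (hpart i hi).trans_lt hΔ, fun i hi => ?_⟩
  · rw [hids]
    refine Nat.mul_le_mul ?_ le_rfl
    exact ((Finset.card_le_card (Finset.filter_subset _ _)).trans_eq hids).trans hN.le
  · refine (hpart i hi).trans_lt ?_
    have : partPal (fun _ => 0) (fun _ _ => True) (colAfter ids nbr pal (fun _ => 0) (fun x => x)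
        (fun _ _ => True) n 0) (nbr i) (pal i) i = pal i := by
      ext c
      simp [mem_partPal, mem_avail, colAfter]
    change Δ < (partPal (fun _ => 0) (fun _ _ => True) (colAfter ids nbr pal (fun _ => 0)
      (fun x => x) (fun _ _ => True) n 0) (nbr i) (pal i) i).card
    rw [this, hpal i hi]
    exact Δ.lt_succ_self

theorem exists_succeeds_of_root {n m Δ a d B : ℕ} (hm : 16 ≤ m) (hΔ : m ^ 8 ≤ Δ)
    (hΔ' : Δ < 2 * m ^ 8) (hn : Δ < n)
    (hp : 2 * Real.exp (-((m : ℝ) / 32) ^ 2 / 4) ≤ 1 / (2 ^ logBits n : ℝ) ^ (d + 8))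
    (hB : 5 * (a + d + 10) + (a + 1) + 12 * (a + 1) ≤ B) :
    ∃ A : Algorithm (B * logBits n), Succeeds n Δ (2 ^ (a * logBits n)) 21 d A := by
  classical
  have hm0 : (0 : ℝ) < m := by
    have : (16 : ℝ) ≤ m := by exact_mod_cast hm
    linarith
  have hL2 := two_le_two_pow_logBits n
  have hnL := lt_two_pow_logBits n
  set L := 2 ^ logBits n with hL
  have hLr : (2 ^ logBits n : ℝ) = L := by rw [hL]; push_cast; rfl
  rw [hLr] at hp
  have hL0 : (0 : ℝ) < L := by exact_mod_cast (by omega : 0 < L)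
  -- The factor `L ^ d` yields the failure probability and `L ^ 8` generously covers the union bound
  -- over vertices and test sets.
  set p : ℝ := 1 / (L : ℝ) ^ (d + 8) with hpd
  have hp0 : 0 < p := by positivity
  have hm4 : m ^ 4 ≤ n := ((Nat.pow_le_pow_right (by omega) (by norm_num)).trans hΔ).trans hn.le
  set b₀ := (a + d + 10) * logBits n with hb₀
  have hcard : (Fintype.card (Message b₀) : ℝ) = (L : ℝ) ^ (a + d + 10) := by
    simp only [Message, Fintype.card_fun, Fintype.card_bool, Fintype.card_fin, hb₀, hL]
    push_cast
    rw [← pow_mul, mul_comm]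
  have hD : 2 ^ (a * logBits n) = L ^ a := by rw [hL, ← pow_mul, mul_comm]
  -- Seed words of `(a + d + 10) * logBits n` bits leave an exponent `L ^ (a + 2)`, enough for all
  -- `2 ^ (D + w)` pairs of sets with `D = L ^ a` and `w ≤ n`.
  have hpc : p * Fintype.card (Message b₀) = (L : ℝ) ^ (a + 2) := by
    rw [hcard, hpd, one_div, inv_mul_eq_iff_eq_mul₀ (by positivity), ← pow_add]
    congr 1; omega
  have hfam : ∀ w : ℕ, w ≤ m ^ 4 →
      (2 : ℝ) ^ (2 ^ (a * logBits n) + w) ≤ Real.exp (p * Fintype.card (Message b₀)) := by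
    intro w hw
    have h1 : 2 ^ (a * logBits n) + w ≤ L ^ (a + 2) := by
      rw [hD]
      calc L ^ a + w ≤ L ^ (a + 1) + L ^ (a + 1) := by
            refine Nat.add_le_add (Nat.pow_le_pow_right (by omega) (by omega)) ?_
            exact (hw.trans (hm4.trans hnL.le)).trans (Nat.le_self_pow (by omega) L)
        _ = L ^ (a + 1) * 2 := by ring
        _ ≤ L ^ (a + 1) * L := Nat.mul_le_mul_left _ hL2
        _ = L ^ (a + 2) := by ring
    rw [hpc]
    calc (2 : ℝ) ^ (2 ^ (a * logBits n) + w) ≤ 2 ^ (L ^ (a + 2)) :=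
          pow_le_pow_right₀ one_le_two h1
      _ ≤ Real.exp 1 ^ (L ^ (a + 2)) := by
          gcongr
          linarith [Real.exp_one_gt_d9]
      _ = Real.exp ((L : ℝ) ^ (a + 2)) := by
          rw [← Real.exp_nat_mul, mul_one]; push_cast; rfl
  have hκ : (0 : ℝ) < (m : ℝ) / 32 := by positivity
  obtain ⟨X, hX, hXd⟩ := exists_hashFamily (Message b₀) (2 ^ (a * logBits n)) (w := m ^ 4)
    (by positivity) hκ hp (hfam _ le_rfl)
  have hH : ∀ t : Fin 4, ∃ h : Message b₀ → ℕ → ℕ, ∀ S ⊆ Finset.range (2 ^ (a * logBits n)),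
      ∀ T ⊆ Finset.range (m ^ (4 - (t : ℕ)) - m ^ (3 - (t : ℕ))),
        (({s | Deviates (m / 32) (m ^ (4 - (t : ℕ)) - m ^ (3 - (t : ℕ))) (h s) S T} :
          Finset _).card : ℝ) ≤ 4 * p * Fintype.card (Message b₀) := fun t => by
    have hlt : m ^ (3 - (t : ℕ)) < m ^ (4 - (t : ℕ)) :=
      Nat.pow_lt_pow_right (by omega) (by omega)
    obtain ⟨h, -, hh⟩ := exists_hashFamily (Message b₀) (2 ^ (a * logBits n))
      (w := m ^ (4 - (t : ℕ)) - m ^ (3 - (t : ℕ))) (by omega) hκ hp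
      (hfam _ ((Nat.sub_le _ _).trans (Nat.pow_le_pow_right (by omega) (by omega))))
    exact ⟨h, hh⟩
  choose H hHd using hH
  refine exists_algorithm_of_scheme (by omega) (T := 5) (C := 6) (s := 3 * m ^ 4) (d := d)
    (b₀ := b₀) (layered m X H) (layered_disjoint m X H)
    (by rw [hb₀, ← mul_assoc]; exact Nat.mul_le_mul_right _ (by omega))
    (words_le (by omega)) (word_le (by omega)) ?_
  intro ids nbr pal hids hidsD hnbrD hnbr hpalD hpal _
  have hsub : ({r | ¬ (layered m X H).Good r 5 6 (3 * m ^ 4) ids nbr pal} :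
      Finset (Fin 5 → Message b₀)) ⊆
      ({r | BadLabels m X ids nbr (r (Fin.last 4)) ∨
        ∃ t : Fin 4, BadColors m Δ X H ids nbr pal t (r t.castSucc) r} :
          Finset (Fin 5 → Message b₀)) := by
    intro r hr
    refine Finset.mem_filter.2 ⟨Finset.mem_univ r, ?_⟩
    by_contra! hcon
    exact (Finset.mem_filter.1 hr).2 (layered_good hm hΔ hΔ' (hids ▸ hn) hX hnbr hpal hcon.1 hcon.2)
  have hbad := card_bad_le (Δ := Δ) (by omega : 1 ≤ m) hX hidsD hnbrD hpalD
    (by positivity : 0 ≤ 4 * p) hXd hHd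
  have hle := (Nat.cast_le (α := ℝ)).2 (Finset.card_le_card hsub)
  have hpoly : ((ids.card + 1) * (m ^ 4 + 5) + 4 * ids.card : ℝ) * (4 * p) * (n : ℝ) ^ d ≤ 1 := by
    have h1 : ((ids.card + 1) * (m ^ 4 + 5) + 4 * ids.card) * 4 ≤ L ^ 8 := by
      rw [hids]
      have h2 : (n + 1) * (m ^ 4 + 5) ≤ L * (4 * L) := Nat.mul_le_mul (by omega) (by omega)
      have h3 : 4 * n ≤ 2 * L * L := by nlinarith
      calc ((n + 1) * (m ^ 4 + 5) + 4 * n) * 4 ≤ (L * (4 * L) + 2 * L * L) * 4 :=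
            Nat.mul_le_mul_right _ (add_le_add h2 h3)
        _ = 24 * L ^ 2 := by ring
        _ ≤ L ^ 6 * L ^ 2 := by
          refine Nat.mul_le_mul_right _ ?_
          exact le_trans (by norm_num) (Nat.pow_le_pow_left hL2 6)
        _ = L ^ 8 := by ring
    have h2 : ((ids.card + 1) * (m ^ 4 + 5) + 4 * ids.card : ℝ) * 4 ≤ (L : ℝ) ^ 8 := by
      exact_mod_cast h1
    have h3 : (n : ℝ) ^ d ≤ (L : ℝ) ^ d := by
      gcongr
    calc ((ids.card + 1) * (m ^ 4 + 5) + 4 * ids.card : ℝ) * (4 * p) * (n : ℝ) ^ d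
        = ((ids.card + 1) * (m ^ 4 + 5) + 4 * ids.card : ℝ) * 4 * (n : ℝ) ^ d * p := by ring
      _ ≤ (L : ℝ) ^ 8 * (L : ℝ) ^ d * p := by gcongr
      _ = 1 := by rw [hpd, ← pow_add, add_comm 8 d]; field_simp
  calc _ ≤ (((ids.card + 1) * (m ^ 4 + 5) + 4 * ids.card : ℝ) * (4 * p) *
        Fintype.card (Fin 5 → Message b₀)) * (n : ℝ) ^ d := by
        gcongr
        exact hle.trans hbad
    _ = ((ids.card + 1) * (m ^ 4 + 5) + 4 * ids.card : ℝ) * (4 * p) * (n : ℝ) ^ d *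
        Fintype.card (Fin 5 → Message b₀) := by ring
    _ ≤ 1 * Fintype.card (Fin 5 → Message b₀) := by gcongr
    _ = _ := one_mul _

/-- The factor `log n ^ ε` only serves to absorb constants: what is used is `Δ ≥ (4 * K * log n) ^
4`. -/
theorem exists_root {ε c : ℝ} (hε : 0 < ε) (hc : 0 < c) (k : ℕ) :
    ∃ N : ℕ, ∀ n ≥ N, ∀ Δ : ℕ, c * Real.log n ^ (4 + ε) ≤ Δ →
      ∃ m : ℕ, 16 ≤ m ∧ m ^ 8 ≤ Δ ∧ Δ < 2 * m ^ 8 ∧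
        2 * Real.exp (-((m : ℝ) / 32) ^ 2 / 4) ≤ 1 / (2 ^ logBits n : ℝ) ^ k := by
  -- The exponent is `m ^ 2 / 4096`, and `log (2 ^ logBits n) ≤ 2 * log n`; the extra `1` pays for
  -- the factor `2` in front of the exponential.
  set K : ℝ := 4096 * (2 * k + 1) with hK
  have hK0 : 4096 ≤ K := by
    have : (0 : ℝ) ≤ k := Nat.cast_nonneg k
    rw [hK]; linarith
  have hlog : Filter.Tendsto (fun n : ℕ => Real.log n) Filter.atTop Filter.atTop :=
    Real.tendsto_log_atTop.comp tendsto_natCast_atTop_atTop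
  have hpow := (tendsto_rpow_atTop hε).comp hlog
  obtain ⟨N, hN⟩ := Filter.eventually_atTop.1
    (((hlog.eventually_ge_atTop 1).and (hpow.eventually_ge_atTop ((4 * K) ^ 4 / c))).and
      (Filter.eventually_gt_atTop 0))
  refine ⟨N, fun n hn Δ hΔ => ?_⟩
  obtain ⟨⟨hl1, hlε⟩, hn0⟩ := hN n hn
  set l := Real.log n with hl
  have hl0 : 0 < l := by linarith
  have hΔl : (4 * K * l) ^ 4 ≤ Δ := by
    refine le_trans ?_ hΔ
    rw [Function.comp_apply, div_le_iff₀ hc] at hlε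
    rw [Real.rpow_add hl0, mul_pow, show l ^ (4 : ℝ) = l ^ 4 by exact_mod_cast Real.rpow_natCast l 4]
    calc (4 * K) ^ 4 * l ^ 4 ≤ l ^ ε * c * l ^ 4 := by gcongr
      _ = _ := by ring
  let m := Nat.findGreatest (fun m => m ^ 8 ≤ Δ) Δ
  have hm8 : m ^ 8 ≤ Δ := Nat.findGreatest_spec (P := fun m => m ^ 8 ≤ Δ) (Nat.zero_le Δ) (by simp)
  have hm8' : Δ < (m + 1) ^ 8 := by
    by_contra! hcon
    have h1 : m + 1 ≤ Δ := (Nat.le_self_pow (by norm_num) _).trans hcon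
    exact absurd (Nat.le_findGreatest (P := fun m => m ^ 8 ≤ Δ) h1 hcon) (by simp [m])
  have h1 : 4 * K * l < ((m : ℝ) + 1) ^ 2 := by
    have h2 : (4 * K * l) ^ 4 < (((m : ℝ) + 1) ^ 2) ^ 4 := by
      rw [← pow_mul]
      exact hΔl.trans_lt (by exact_mod_cast hm8')
    exact lt_of_pow_lt_pow_left₀ 4 (by positivity) h2
  have hm1 : 1 ≤ m := by
    by_contra! h0
    obtain h0 : m = 0 := by omega
    have h2 : 4096 ≤ K * l := by nlinarith
    rw [h0] at h1
    norm_num at h1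
    linarith
  have hmK : K * l ≤ (m : ℝ) ^ 2 := by
    have : (1 : ℝ) ≤ m := by exact_mod_cast hm1
    nlinarith
  have hm16 : 16 ≤ m := by
    have h2 : (16 : ℝ) ^ 2 ≤ (m : ℝ) ^ 2 := by nlinarith
    exact_mod_cast (pow_le_pow_iff_left₀ (by norm_num) (Nat.cast_nonneg m) two_ne_zero).1 h2
  refine ⟨m, hm16, hm8, hm8'.trans_le ?_, ?_⟩
  -- Since `m ≥ 16`, `(m + 1) ^ 8 ≤ (17 / 16) ^ 8 * m ^ 8`, and `(17 / 16) ^ 8 < 2`.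
  · refine le_of_mul_le_mul_left ?_ (by norm_num : 0 < 16 ^ 8)
    calc 16 ^ 8 * (m + 1) ^ 8 = (16 * (m + 1)) ^ 8 := by rw [mul_pow]
      _ ≤ (17 * m) ^ 8 := Nat.pow_le_pow_left (by omega) 8
      _ = 17 ^ 8 * m ^ 8 := by rw [mul_pow]
      _ ≤ (16 ^ 8 * 2) * m ^ 8 := Nat.mul_le_mul_right _ (by norm_num)
      _ = _ := by ring
  · have hL : (2 ^ logBits n : ℝ) ≤ 2 * n := by exact_mod_cast two_pow_logBits_le hn0
    have hL0 : (0 : ℝ) < 2 ^ logBits n := by positivity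
    have hlogL : Real.log (2 ^ logBits n) ≤ 2 * l := by
      have h2 := Real.log_le_log hL0 hL
      rw [Real.log_mul two_ne_zero (by positivity)] at h2
      linarith [Real.log_two_lt_d9]
    have h3 : 2 * Real.exp (-((m : ℝ) / 32) ^ 2 / 4) =
        Real.exp (Real.log 2 + -((m : ℝ) / 32) ^ 2 / 4) := by
      rw [Real.exp_add, Real.exp_log two_pos]
    have h4 : 1 / (2 ^ logBits n : ℝ) ^ k = Real.exp (-(k * Real.log (2 ^ logBits n))) := by
      rw [Real.exp_neg, Real.exp_nat_mul, Real.exp_log hL0, one_div]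
    rw [h3, h4]
    refine Real.exp_le_exp.2 ?_
    have h5 : (k : ℝ) * Real.log (2 ^ logBits n) ≤ k * (2 * l) := by gcongr
    have h6 : ((m : ℝ) / 32) ^ 2 / 4 = (m : ℝ) ^ 2 / 4096 := by ring
    have h7 : K * l / 4096 = (2 * k + 1) * l := by rw [hK]; ring
    have h8 : K * l / 4096 ≤ (m : ℝ) ^ 2 / 4096 := by gcongr
    have h9 := Real.log_two_lt_d9
    rw [neg_div, h6]
    linarith

end CongestedClique

theorem mainTheorem4 (ε : ℝ) (hε : 0 < ε) (c : ℝ) (hc : 0 < c) (N : ℕ) (a d : ℕ) :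
    ∃ (R B : ℕ) (A : (n Δ : ℕ) → CongestedClique.Algorithm (B * CongestedClique.logBits n)),
      ∀ (n : ℕ) (G : SimpleGraph (Fin n)) [DecidableRel G.Adj],
        (N ≤ n → c * Real.log n ^ (4 + ε) ≤ G.maxDegree) →
        ∀ ident : Fin n → ℕ, Function.Injective ident →
        (∀ v, ident v < 2 ^ (a * CongestedClique.logBits n)) →
        ∀ Ψ : Fin n → Finset ℕ, (∀ v, (Ψ v).card = G.maxDegree + 1) →
        (∀ v, ∀ x ∈ Ψ v, x < 2 ^ (a * CongestedClique.logBits n)) →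
        CongestedClique.coins n {ω | ¬ CongestedClique.IsListColoring G Ψ
            (CongestedClique.result (A n G.maxDegree) R G ident Ψ ω)} ≤ 1 / (n : ℝ≥0∞) ^ d := by
  classical
  obtain ⟨N₀, hN₀⟩ := CongestedClique.exists_root hε hc (d + 8)
  set N₁ := max N N₀ with hN₁
  set B := 5 * (a + d + 10) + (a + 1) + 12 * (a + 1) + 2 * (a + 1) * N₁ with hB
  have key : ∀ n Δ : ℕ, ∃ A : CongestedClique.Algorithm (B * CongestedClique.logBits n), 0 < n →
      Δ < n → (N ≤ n → c * Real.log n ^ (4 + ε) ≤ Δ) →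
      CongestedClique.Succeeds n Δ (2 ^ (a * CongestedClique.logBits n)) 21 d A := by
    intro n Δ
    by_cases h : 0 < n ∧ Δ < n ∧ (N ≤ n → c * Real.log n ^ (4 + ε) ≤ Δ)
    · obtain ⟨hn, hΔn, hΔ⟩ := h
      rcases lt_or_ge n N₁ with hlt | hge
      · obtain ⟨A, hA⟩ := CongestedClique.exists_succeeds_of_lt (a := a) (d := d) (B := B) hn hlt Δ
          (by omega)
        exact ⟨A, fun _ _ _ => hA⟩
      · obtain ⟨m, hm, hm8, hm8', hp⟩ := hN₀ n ((le_max_right _ _).trans hge) Δ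
          (hΔ ((le_max_left _ _).trans hge))
        obtain ⟨A, hA⟩ := CongestedClique.exists_succeeds_of_root (a := a) (d := d) (B := B) hm hm8
          hm8' hΔn hp (by omega)
        exact ⟨A, fun _ _ _ => hA⟩
    -- No instance has these parameters, so any algorithm will do.
    · exact ⟨⟨Unit, fun _ _ => (), fun _ _ _ => false, fun _ _ => (), fun _ => 0⟩,
        fun h1 h2 h3 => absurd ⟨h1, h2, h3⟩ h⟩
  choose A hA using key
  refine ⟨21, B, A, fun n G inst hΔ ident hid hidD Ψ hΨ hΨD => ?_⟩
  rcases Nat.eq_zero_or_pos n with rfl | hn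
  · have : {ω | ¬ CongestedClique.IsListColoring G Ψ
        (CongestedClique.result (A 0 G.maxDegree) 21 G ident Ψ ω)} = ∅ :=
      Set.eq_empty_of_forall_notMem fun ω hω => hω ⟨fun v => v.elim0, fun v => v.elim0⟩
    rw [this, measure_empty]
    exact zero_le
  · have hlt : G.maxDegree < n := by
      have : Nonempty (Fin n) := ⟨⟨0, hn⟩⟩
      obtain ⟨u, hu⟩ := G.exists_maximal_degree_vertex
      rw [hu]
      simpa using G.degree_lt_card_verts u
    exact hA n G.maxDegree hn hlt hΔ G rfl ident hid hidD Ψ hΨ hΨD
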